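/- Let $c>1$, $0<2d<c-1$, $I_1=[-c-2d,-c+2d]$, $I_2=[-1,1]$, and let $a(n)>0$, $b(n)\in\mathbb R$ $(n\in\mathbb Z)$ satisfy $$\sum_{n\le 0}e^{C|n|}\big(|a(n)-d|+|b(n)+c|\big)+\sum_{n\ge 0}e^{Cn}\big(|a(n)-\tfrac12|+|b(n)|\big)<\infty$$ for some $C\ge\max\{c+2d+\sqrt{(c+2d)^2-1},\ \tfrac1{2d}(1+c+\sqrt{(1+c)^2-4d^2})\}$. Assume that the Jacobi operator $(Hy)(n)=a(n-1)y(n-1)+b(n)y(n)+a(n)y(n+1)$ on $\ell^2(\mathbb Z)$ has no eigenvalues. Let $\mathbb M$ be the two-sheeted Riemann surface of $\sqrt{(\lambda^2-1)((\lambda+c)^2-4d^2)}$, obtained by gluing two copies $\Pi_U,\Pi_L$ (the upper and the lower sheet, $p=(\lambda,\pm)$) of $(\mathbb C\cup\{\infty\})\setminus(I_1\cup I_2)$ crosswise along the bands; $p^*$ is the point over the same $\lambda$ on the other sheet, $\infty_\pm$ are the points at infinity, and $\Sigma=\Sigma_1\cup\Sigma_2$, where $\Sigma_j$ consists of the points $(\lambda\pm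 i0,+)$, $\lambda\in I_j$. For a function $f$ on $\mathbb M\setminus\Sigma$ and $p\in\Sigma$ let $f_+(p)$ and $f_-(p)$ be the limits of $f$ at $p$ from $\Pi_U$ and from $\Pi_L$. On $\Pi_U$ put $$z_2=\lambda-\sqrt{\lambda^2-1},\qquad z_1=\tfrac1{2d}\big(\lambda+c-\sqrt{(\lambda+c)^2-4d^2}\big),\qquad |z_j|<1,$$ $$\Phi_1=d(z_1^{-1}-z_1)-\xi\log z_1,\qquad \Phi_2=\tfrac12(z_2-z_2^{-1})+\xi\log z_2,\qquad \xi=\tfrac nt,$$ and $\Phi_j(p^*)=-\Phi_j(p)$ (functions without a subscript $\pm$ are evaluated on $\Sigma$ as limits from $\Pi_U$). Let $\psi_1,\psi_2$ be the Jost solutions, i.e. the solutions of $H\psi=\lambda\psi$ with $z_1^{n}\psi_1(n)\to1$ as $n\to-\infty$ and $z_2^{-n}\psi_2(n)\to1$ as $n\to+\infty$, let $W=a(n-1)\big(\psi_1(n-1)\psi_2(n)-\psi_1(n)\psi_2(n-1)\big)$ be their Wronskian, and assume that $W\ne0$ at the four points $-c\pm2d,\pm1$. Put $T_2=-\sqrt{\lambda^2-1}/W$,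 $T_1=-\sqrt{(\lambda+c)^2-4d^2}/W$, $\chi=-T_1\overline{T_2}$ on $\Sigma$, and define the reflection coefficients by $T_1\psi_2=\overline{\psi_1}+R_1\psi_1$ on $\Sigma_1$ and $T_2\psi_1=\overline{\psi_2}+R_2\psi_2$ on $\Sigma_2$. Fix $n\in\mathbb Z$, $t>0$ and $j\in\{1,2\}$; let $k$ be the other index, and set $\chi_2=\chi$, $\chi_1=\overline\chi$. Consider the Riemann--Hilbert problem of finding $m:\mathbb M\setminus\Sigma\to\mathbb C^2$ (row vectors), holomorphic on $\mathbb M\setminus\Sigma$, such that I. at every $p\in\Sigma$ the limits $m_\pm(p)$ exist and $m_+(p)=m_-(p)v_j(p)$, where $$v_j=\begin{pmatrix}0&-\overline{R_j}\,e^{-2t\Phi_j}\\ R_j\,e^{2t\Phi_j}&1\end{pmatrix}\text{ on }\Sigma_j,\qquad v_j=\begin{pmatrix}\chi_j\,e^{t(\Phi_{j,+}-\Phi_{j,-})}&e^{-t(\Phi_{j,+}+\Phi_{j,-})}\\ e^{t(\Phi_{j,+}+\Phi_{j,-})}&0\end{pmatrix}\text{ on }\Sigma_k;$$ II. $m(p^*)=m(p)\begin{pmatrix}0&1\\1&0\end{pmatrix}$;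 III. $\lim_{p\in\Pi_U,\,p\to\infty_+}m(p)=(\hat m,\tilde m)$ with $\hat m\,\tilde m=1$ and $\hat m>0$. Then the solution is unique: any two solutions of this problem coincide on $\mathbb M\setminus\Sigma$. Moreover, the vanishing problem, in which III is replaced by the condition that the first component of $m(\infty_+)$ is $0$, has only the solution $m\equiv0$. -/

import Mathlib

open Filter Topology Matrix
open scoped ComplexConjugate

noncomputable section

namespace TodaShock

/-! ### The two-sheeted surface cut along the contour -/

/-- The two sheets of the Riemann surface of `√((λ² - 1)((λ + c)² - 4d²))`. -/
inductive Sheet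
  | upper
  | lower

/-- Sheet exchange. -/
def Sheet.flip : Sheet → Sheet
  | .upper => .lower
  | .lower => .upper

/-- The side of a cut on the upper sheet: `up` is `x + i0`, `down` is `x - i0`. -/
inductive Side
  | up
  | down

/-- The opposite side of the cut. -/
def Side.flip : Side → Side
  | .up => .down
  | .down => .up

/-- The spectrum `I₁ = [-c - 2d, -c + 2d]` of the left background. -/
def bandOne (c d : ℝ) : Set ℝ := Set.Icc (-c - 2 * d) (-c + 2 * d)

/-- The spectrum `I₂ = [-1, 1]` of the right background. -/
def bandTwo : Set ℝ := Set.Icc (-1) 1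

/-- The four edges of the bands (the branch points of the surface). -/
def edges (c d : ℝ) : Set ℝ := {-c - 2 * d, -c + 2 * d, -1, 1}

/-- `I₁ ∪ I₂` as a subset of the complex plane. -/
def cuts (c d : ℝ) : Set ℂ := (fun x : ℝ => (x : ℂ)) '' (bandOne c d ∪ bandTwo)

/-- Points `(λ, ±)`, `λ ∈ ℂ ∪ {∞}`, of the surface. Only the points off the contour `Σ` over
`I₁ ∪ I₂` are used in this form; a point of `Σ` is given by `x ∈ I₁ ∪ I₂` and a `Side`. -/
abbrev SurfPt : Type := Sheet × OnePoint ℂ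

/-- The sheet exchange map `p ↦ p*`. -/
def star (p : SurfPt) : SurfPt := (p.1.flip, p.2)

/-- The surface without the contour `Σ`: two copies of `(ℂ ∪ {∞}) \ (I₁ ∪ I₂)`. -/
def offContour (c d : ℝ) : Set SurfPt :=
  {p | p.2 ∉ (fun z : ℂ => (z : OnePoint ℂ)) '' cuts c d}

/-- The local parameter `w = 1/λ` at infinity, as a map `w ↦ λ`. -/
def inftyChart (w : ℂ) : OnePoint ℂ := if w = 0 then OnePoint.infty else ((w⁻¹ : ℂ) : OnePoint ℂ)

/-- Holomorphy on the surface away from `Σ`, the points `∞₊` and `∞₋` included. -/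
def HolomorphicOffContour (c d : ℝ) (m : SurfPt → Fin 2 → ℂ) : Prop :=
  ∀ s : Sheet,
    DifferentiableOn ℂ (fun z : ℂ => m (s, (z : OnePoint ℂ))) (cuts c d)ᶜ ∧
      DifferentiableAt ℂ (fun w : ℂ => m (s, inftyChart w)) 0

open Classical in
/-- The trace on one sheet of the neighbourhoods of the boundary point `x ± i0`. At a branch point
both sides of the cut belong to every neighbourhood. -/
def approach (c d x : ℝ) (σ : Side) : Filter ℂ :=
  if x ∈ edges c d then 𝓝[(cuts c d)ᶜ] (x : ℂ)
  else
    match σ with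
    | .up => 𝓝[{z : ℂ | 0 < z.im}] (x : ℂ)
    | .down => 𝓝[{z : ℂ | z.im < 0}] (x : ℂ)

/-- `v` is the limit `m₊(p)` of `m` from the upper sheet at the point `p = (x ± i0, +)` of `Σ`. -/
def HasPlusLimit (c d : ℝ) (m : SurfPt → Fin 2 → ℂ) (x : ℝ) (σ : Side) (v : Fin 2 → ℂ) : Prop :=
  Tendsto (fun z : ℂ => m (.upper, (z : OnePoint ℂ))) (approach c d x σ) (𝓝 v)

/-- `v` is the limit `m₋(p)` of `m` from the lower sheet at the point `p = (x ± i0, +)` of `Σ`.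
The sheets are glued crosswise: `(x + i0, +)` is the same point as `(x - i0, -)`. -/
def HasMinusLimit (c d : ℝ) (m : SurfPt → Fin 2 → ℂ) (x : ℝ) (σ : Side) (v : Fin 2 → ℂ) : Prop :=
  Tendsto (fun z : ℂ => m (.lower, (z : OnePoint ℂ))) (approach c d x σ.flip) (𝓝 v)

/-! ### Vector Riemann--Hilbert problems on the surface -/

/-- Conditions common to the problem and to the associated vanishing problem, for a jump matrix `v`
on `Σ`: holomorphy off `Σ`, the jump condition `m₊ = m₋ v` at all points of `Σ` (where both limits
exist) and the symmetry condition. -/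
structure IsPreSolution (c d : ℝ) (v : ℝ → Side → Matrix (Fin 2) (Fin 2) ℂ)
    (m : SurfPt → Fin 2 → ℂ) : Prop where
  holomorphic : HolomorphicOffContour c d m
  jump : ∀ x ∈ bandOne c d ∪ bandTwo, ∀ σ : Side, ∃ mPlus mMinus : Fin 2 → ℂ,
    HasPlusLimit c d m x σ mPlus ∧ HasMinusLimit c d m x σ mMinus ∧ mPlus = mMinus ᵥ* v x σ
  symmetry : ∀ p ∈ offContour c d, m (star p) = m p ᵥ* !![0, 1; 1, 0]

/-- Solutions of the Riemann--Hilbert problem: additionally `m → (m̂, m̃)` at `∞₊` with `m̂ m̃ = 1`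
and `m̂ > 0`. -/
structure IsSolution (c d : ℝ) (v : ℝ → Side → Matrix (Fin 2) (Fin 2) ℂ)
    (m : SurfPt → Fin 2 → ℂ) : Prop extends IsPreSolution c d v m where
  normalization : ∃ (mHat : ℝ) (mTilde : ℂ),
    Tendsto (fun z : ℂ => m (.upper, (z : OnePoint ℂ))) (cocompact ℂ) (𝓝 ![(mHat : ℂ), mTilde]) ∧
      (mHat : ℂ) * mTilde = 1 ∧ 0 < mHat

/-- Solutions of the vanishing problem: the first component vanishes at `∞₊`. -/
structure IsVanishingSolution (c d : ℝ) (v : ℝ → Side → Matrix (Fin 2) (Fin 2) ℂ)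
    (m : SurfPt → Fin 2 → ℂ) : Prop extends IsPreSolution c d v m where
  vanishing : m (.upper, OnePoint.infty) 0 = 0

/-! ### Joukovski variables and phases on the contour

Parameters `α > 0`, `β` stand for the background operator `α y(n-1) + β y(n) + α y(n+1)` with
spectrum `[β - 2α, β + 2α]`: `(d, -c)` on the left and `(1/2, 0)` on the right. -/

/-- The branch of `√((λ - β)² - 4α²)` that is holomorphic off `[β - 2α, β + 2α]` and behaves like
`λ` at infinity; for real `λ` this formula gives the limit from the upper half-plane. -/
def cutRoot (α β : ℝ) (z : ℂ) : ℂ := Complex.sqrt (z - β - 2 * α) * Complex.sqrt (z - β + 2 * α)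

/-- Boundary value of `cutRoot` at `x ± i0`. -/
def rootAt (α β x : ℝ) : Side → ℂ
  | .up => cutRoot α β x
  | .down => conj (cutRoot α β x)

/-- Boundary value at `x ± i0` of the Joukovski variable
`z = (λ - β - √((λ - β)² - 4α²)) / (2α)`, which satisfies `|z| < 1` on the upper sheet. -/
def zAt (α β x : ℝ) (σ : Side) : ℂ := ((x : ℂ) - β - rootAt α β x σ) / (2 * α)

def z₁ (c d x : ℝ) (σ : Side) : ℂ := zAt d (-c) x σ

def z₂ (x : ℝ) (σ : Side) : ℂ := zAt (1 / 2) 0 x σ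

/-- Boundary values from the upper sheet of `Φ₁ = d (z₁⁻¹ - z₁) - ξ log z₁`. The principal logarithm
(with `log x = log |x| + iπ` for `x < 0`) is the limit from the lower half-plane of `λ`, and
`Φ₁` takes complex conjugate values at conjugate points. -/
def Φ₁ (c d ξ x : ℝ) : Side → ℂ
  | .down => d * ((z₁ c d x .down)⁻¹ - z₁ c d x .down) - ξ * Complex.log (z₁ c d x .down)
  | .up => conj (d * ((z₁ c d x .down)⁻¹ - z₁ c d x .down) - ξ * Complex.log (z₁ c d x .down))

/-- Boundary values from the upper sheet of `Φ₂ = (z₂ - z₂⁻¹) / 2 + ξ log z₂`. -/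
def Φ₂ (ξ x : ℝ) : Side → ℂ
  | .down => (z₂ x .down - (z₂ x .down)⁻¹) / 2 + ξ * Complex.log (z₂ x .down)
  | .up => conj ((z₂ x .down - (z₂ x .down)⁻¹) / 2 + ξ * Complex.log (z₂ x .down))

/-- Boundary values of `Φ₁` from the lower sheet, where `Φ₁(p*) = -Φ₁(p)`. -/
def Φ₁Minus (c d ξ x : ℝ) (σ : Side) : ℂ := -Φ₁ c d ξ x σ.flip

/-- Boundary values of `Φ₂` from the lower sheet, where `Φ₂(p*) = -Φ₂(p)`. -/
def Φ₂Minus (ξ x : ℝ) (σ : Side) : ℂ := -Φ₂ ξ x σ.flip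

/-! ### Scattering data of a Jacobi operator with steplike coefficients -/

/-- `H ψ = E ψ` for `(H ψ)(n) = a(n-1) ψ(n-1) + b(n) ψ(n) + a(n) ψ(n+1)`. -/
def IsJacobiSolution (a b : ℤ → ℝ) (E : ℂ) (ψ : ℤ → ℂ) : Prop :=
  ∀ n : ℤ, a (n - 1) * ψ (n - 1) + b n * ψ n + a n * ψ (n + 1) = E * ψ n

/-- The left Jost solution at `p = (x ± i0, +)`: the solution with `z₁ⁿ ψ₁(n) → 1`, `n → -∞`. -/
def IsLeftJost (c d : ℝ) (a b : ℤ → ℝ) (x : ℝ) (σ : Side) (ψ : ℤ → ℂ) : Prop :=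
  IsJacobiSolution a b x ψ ∧ Tendsto (fun n : ℤ => z₁ c d x σ ^ n * ψ n) atBot (𝓝 1)

/-- The right Jost solution at `p = (x ± i0, +)`: the solution with `z₂⁻ⁿ ψ₂(n) → 1`, `n → +∞`. -/
def IsRightJost (a b : ℤ → ℝ) (x : ℝ) (σ : Side) (ψ : ℤ → ℂ) : Prop :=
  IsJacobiSolution a b x ψ ∧ Tendsto (fun n : ℤ => z₂ x σ ^ (-n) * ψ n) atTop (𝓝 1)

def ψ₁ (c d : ℝ) (a b : ℤ → ℝ) (x : ℝ) (σ : Side) : ℤ → ℂ :=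
  Classical.epsilon (IsLeftJost c d a b x σ)

def ψ₂ (a b : ℤ → ℝ) (x : ℝ) (σ : Side) : ℤ → ℂ :=
  Classical.epsilon (IsRightJost a b x σ)

/-- The Wronskian `a(n-1) (ψ₁(n-1) ψ₂(n) - ψ₁(n) ψ₂(n-1))` of the Jost solutions, taken at `n = 1`
(it does not depend on `n`). -/
def W (c d : ℝ) (a b : ℤ → ℝ) (x : ℝ) (σ : Side) : ℂ :=
  a 0 * (ψ₁ c d a b x σ 0 * ψ₂ a b x σ 1 - ψ₁ c d a b x σ 1 * ψ₂ a b x σ 0)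

/-- The left transmission coefficient on `Σ`. -/
def T₁ (c d : ℝ) (a b : ℤ → ℝ) (x : ℝ) (σ : Side) : ℂ := -rootAt d (-c) x σ / W c d a b x σ

/-- The right transmission coefficient on `Σ`. -/
def T₂ (c d : ℝ) (a b : ℤ → ℝ) (x : ℝ) (σ : Side) : ℂ := -rootAt (1 / 2) 0 x σ / W c d a b x σ

/-- The left reflection coefficient on `Σ₁`, given by `T₁ ψ₂ = conj ψ₁ + R₁ ψ₁`. -/
def R₁ (c d : ℝ) (a b : ℤ → ℝ) (x : ℝ) (σ : Side) : ℂ :=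
  Classical.epsilon fun r : ℂ => ∀ n : ℤ,
    T₁ c d a b x σ * ψ₂ a b x σ n = conj (ψ₁ c d a b x σ n) + r * ψ₁ c d a b x σ n

/-- The right reflection coefficient on `Σ₂`, given by `T₂ ψ₁ = conj ψ₂ + R₂ ψ₂`. -/
def R₂ (c d : ℝ) (a b : ℤ → ℝ) (x : ℝ) (σ : Side) : ℂ :=
  Classical.epsilon fun r : ℂ => ∀ n : ℤ,
    T₂ c d a b x σ * ψ₁ c d a b x σ n = conj (ψ₂ a b x σ n) + r * ψ₂ a b x σ n

/-- `χ = -T₁ conj T₂` on `Σ`. -/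
def χ (c d : ℝ) (a b : ℤ → ℝ) (x : ℝ) (σ : Side) : ℂ :=
  -(T₁ c d a b x σ * conj (T₂ c d a b x σ))

/-- The admissible initial data of the Toda shock problem: positive off-diagonal coefficients,
exponentially fast convergence to the two constant backgrounds with non-overlapping spectra, no
eigenvalues, and no resonances at the edges of the spectrum. -/
structure IsShockData (c d : ℝ) (a b : ℤ → ℝ) : Prop where
  one_lt : 1 < c
  d_pos : 0 < d
  separated : 2 * d < c - 1
  a_pos : ∀ n, 0 < a n
  decay : ∃ C : ℝ,
    max (c + 2 * d + √((c + 2 * d) ^ 2 - 1))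
        (1 / (2 * d) * (1 + c + √((1 + c) ^ 2 - 4 * d ^ 2))) ≤ C ∧
      Summable (fun n : ℕ => Real.exp (C * n) * (|a (-(n : ℤ)) - d| + |b (-(n : ℤ)) + c|)) ∧
      Summable (fun n : ℕ => Real.exp (C * n) * (|a (n : ℤ) - 1 / 2| + |b (n : ℤ)|))
  no_eigenvalues : ∀ (E : ℝ) (u : ℤ → ℂ), Memℓp u 2 → IsJacobiSolution a b E u → u = 0
  no_resonances : ∀ x ∈ edges c d, ∀ σ : Side, W c d a b x σ ≠ 0

/-! ### The jump matrices -/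

/-- The jump matrix on the contour over the spectrum of the background in question. -/
def ownJump (t : ℝ) (R Φ : ℂ) : Matrix (Fin 2) (Fin 2) ℂ :=
  !![0, -conj R * Complex.exp (-(2 * t * Φ));
     R * Complex.exp (2 * t * Φ), 1]

/-- The jump matrix on the contour over the spectrum of the other background. -/
def crossJump (t : ℝ) (X ΦPlus ΦMinus : ℂ) : Matrix (Fin 2) (Fin 2) ℂ :=
  !![X * Complex.exp (t * (ΦPlus - ΦMinus)), Complex.exp (-(t * (ΦPlus + ΦMinus)));
     Complex.exp (t * (ΦPlus + ΦMinus)), 0]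

open Classical in
/-- The jump matrix `v₁` of the left problem, with `ξ = n / t`. -/
def v₁ (c d : ℝ) (a b : ℤ → ℝ) (n : ℤ) (t : ℝ) (x : ℝ) (σ : Side) : Matrix (Fin 2) (Fin 2) ℂ :=
  if x ∈ bandOne c d then ownJump t (R₁ c d a b x σ) (Φ₁ c d (n / t) x σ)
  else crossJump t (conj (χ c d a b x σ)) (Φ₁ c d (n / t) x σ) (Φ₁Minus c d (n / t) x σ)

open Classical in
/-- The jump matrix `v₂` of the right problem, with `ξ = n / t`. -/
def v₂ (c d : ℝ) (a b : ℤ → ℝ) (n : ℤ) (t : ℝ) (x : ℝ) (σ : Side) : Matrix (Fin 2) (Fin 2) ℂ :=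
  if x ∈ bandTwo then ownJump t (R₂ c d a b x σ) (Φ₂ (n / t) x σ)
  else crossJump t (χ c d a b x σ) (Φ₂ (n / t) x σ) (Φ₂Minus (n / t) x σ)

end TodaShock

end

/-! A solution is described by its two scalar components on the upper sheet: `f`, `g` on the upper
half-plane and `f'`, `g'`, the conjugate reflections of their restrictions to the lower one. For a
vanishing solution the products `f g'` and `f' g`, divided by the root of the background in
question, decay like `λ⁻²`, so by Cauchy's theorem their boundary values integrate to zero. By the
jump relations a combination of these integrands is nonnegative: it vanishes off the bands, on the
band of the background it is a positive multiple of the squared modulus of one component (the terms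
containing the reflection coefficient cancel), and on the other band it is a positive multiple of
that of the other component. The sign there comes from `χ = -T₁ conj T₂`, which is, up to the factor
`|W|⁻²`, the product of a real and an imaginary root; that `W ≠ 0` inside the bands follows from the
Wronskians of the Jost solutions with their conjugates. Hence every component has zero boundary
values on an interval and vanishes. Uniqueness follows because a real combination of two solutions,
with the normalization at infinity cancelled, is a vanishing solution, and the condition
`m̂ m̃ = 1`, `m̂ > 0` fixes the normalization. -/

noncomputable section

namespace TodaShock

/-! ### Wronskians of Jacobi difference equations -/

/-- The modified Wronskian `a(n-1) (u(n-1) v(n) - u(n) v(n-1))`, which does not depend on `n` when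
`u` and `v` solve the same Jacobi difference equation. -/
def wronskian (a : ℤ → ℝ) (u v : ℤ → ℂ) (n : ℤ) : ℂ :=
  a (n - 1) * (u (n - 1) * v n - u n * v (n - 1))

lemma wronskian_swap (a : ℤ → ℝ) (u v : ℤ → ℂ) (n : ℤ) :
    wronskian a v u n = -wronskian a u v n := by
  simp only [wronskian]
  ring

lemma wronskian_reflect (a : ℤ → ℝ) (u v : ℤ → ℂ) (n : ℤ) :
    wronskian (fun k => a (-k - 1)) (fun k => u (-k)) (fun k => v (-k)) n =
      -wronskian a u v (1 - n) := by
  simp only [wronskian]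
  rw [show -(n - 1) - 1 = -n by ring, show -(n - 1) = 1 - n by ring, show 1 - n - 1 = -n by ring]
  ring

/-- The Plücker relation between the `2 × 2` minors of three solutions. -/
lemma wronskian_mul_eq (a : ℤ → ℝ) (u v w : ℤ → ℂ) (n : ℤ) :
    wronskian a u v n * w n = wronskian a w v n * u n + wronskian a u w n * v n := by
  simp only [wronskian]
  ring

section

variable {a b : ℤ → ℝ} {E : ℂ} {u v : ℤ → ℂ}

lemma IsJacobiSolution.conj {x : ℝ} (hu : IsJacobiSolution a b x u) :
    IsJacobiSolution a b x fun n => conj (u n) := fun n => by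
  simpa using congrArg (starRingEnd ℂ) (hu n)

lemma IsJacobiSolution.reflect (hu : IsJacobiSolution a b E u) :
    IsJacobiSolution (fun n => a (-n - 1)) (fun n => b (-n)) E fun n => u (-n) := fun n => by
  have h := hu (-n)
  beta_reduce
  rw [show -(n - 1) - 1 = -n by ring, show -(n - 1) = -n + 1 by ring,
    show -(n + 1) = -n - 1 by ring]
  linear_combination h

lemma IsJacobiSolution.wronskian_add_one (hu : IsJacobiSolution a b E u)
    (hv : IsJacobiSolution a b E v) (n : ℤ) :
    wronskian a u v (n + 1) = wronskian a u v n := by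
  simp only [wronskian, add_sub_cancel_right]
  linear_combination u n * hv n - v n * hu n

lemma IsJacobiSolution.wronskian_eq (hu : IsJacobiSolution a b E u)
    (hv : IsJacobiSolution a b E v) (m n : ℤ) : wronskian a u v m = wronskian a u v n := by
  induction m using Int.inductionOn' (b := n) with
  | zero => rfl
  | succ k _ ih => rw [hu.wronskian_add_one hv, ih]
  | pred k _ ih => rw [← ih, ← hu.wronskian_add_one hv, sub_add_cancel]

lemma IsJacobiSolution.wronskian_eq_of_tendsto (hu : IsJacobiSolution a b E u)
    (hv : IsJacobiSolution a b E v) {L : ℂ} (h : Tendsto (wronskian a u v) atTop (𝓝 L)) (n : ℤ) :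
    wronskian a u v n = L :=
  tendsto_nhds_unique tendsto_const_nhds (h.congr fun k => hu.wronskian_eq hv k n)

end

/-- The continuation of `φ` from `[N, ∞)` to `ℤ` obtained by running the Jacobi difference equation
backwards. -/
def backwardExtension (a b : ℤ → ℝ) (E : ℂ) (N : ℤ) (φ : ℤ → ℂ) (n : ℤ) : ℂ :=
  if N ≤ n then φ n
  else ((E - b (n + 1)) * backwardExtension a b E N φ (n + 1) -
    a (n + 1) * backwardExtension a b E N φ (n + 2)) / a n
termination_by (N - n).toNat

lemma backwardExtension_of_le (a b : ℤ → ℝ) (E : ℂ) {N n : ℤ} (φ : ℤ → ℂ) (hn : N ≤ n) :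
    backwardExtension a b E N φ n = φ n := by
  rw [backwardExtension, if_pos hn]

lemma isJacobiSolution_backwardExtension {a b : ℤ → ℝ} (ha : ∀ n, a n ≠ 0) {E : ℂ} {N : ℤ}
    {φ : ℤ → ℂ}
    (hφ : ∀ n > N, a (n - 1) * φ (n - 1) + b n * φ n + a n * φ (n + 1) = E * φ n) :
    IsJacobiSolution a b E (backwardExtension a b E N φ) := by
  intro n
  rcases lt_or_ge N n with hn | hn
  · rw [backwardExtension_of_le a b E φ (by lia), backwardExtension_of_le a b E φ hn.le,
      backwardExtension_of_le a b E φ (by lia)]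
    exact hφ n hn
  · rw [backwardExtension, if_neg (by lia), sub_add_cancel, show n - 1 + 2 = n + 1 by ring]
    have hne : (a (n - 1) : ℂ) ≠ 0 := mod_cast ha (n - 1)
    field_simp
    ring

/-! ### Volterra sum equations -/

/-- The discrete Volterra operator `f ↦ ∑_{m ≥ k} κ(m - k) f(m)`. -/
def tailSum (κ f : ℕ → ℂ) (k : ℕ) : ℂ := ∑' j, κ j * f (k + j)

section TailSum

variable {κ f g : ℕ → ℂ} {K : ℝ}

lemma summable_shift {E : Type*} [AddCommGroup E] [TopologicalSpace E] [IsTopologicalAddGroup E]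
    {f : ℕ → E} (hf : Summable f) (k : ℕ) : Summable fun j => f (k + j) := by
  simpa only [add_comm k] using (summable_nat_add_iff k).2 hf

lemma norm_mul_shift_le (hκ : ∀ j, ‖κ j‖ ≤ K) (f : ℕ → ℂ) (k j : ℕ) :
    ‖κ j * f (k + j)‖ ≤ K * ‖f (k + j)‖ := by
  rw [norm_mul]
  gcongr
  exact hκ j

lemma summable_mul_shift (hκ : ∀ j, ‖κ j‖ ≤ K) (hf : Summable f) (k : ℕ) :
    Summable fun j => κ j * f (k + j) :=
  .of_norm_bounded ((summable_shift hf.norm k).mul_left K) (norm_mul_shift_le hκ f k)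

lemma tailSum_sub (hκ : ∀ j, ‖κ j‖ ≤ K) (hf : Summable f) (hg : Summable g) (k : ℕ) :
    tailSum κ f k - tailSum κ g k = tailSum κ (f - g) k := by
  simp only [tailSum, Pi.sub_apply, mul_sub]
  exact ((summable_mul_shift hκ hf k).tsum_sub (summable_mul_shift hκ hg k)).symm

lemma norm_tailSum_le (hκ : ∀ j, ‖κ j‖ ≤ K) (hf : Summable f) (k : ℕ) :
    ‖tailSum κ f k‖ ≤ K * ∑' j, ‖f (k + j)‖ :=
  tsum_of_norm_bounded ((summable_shift hf.norm k).hasSum.mul_left K) (norm_mul_shift_le hκ f k)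

lemma norm_tailSum_le_of_norm_le (hκ : ∀ j, ‖κ j‖ ≤ K) {ε : ℕ → ℝ} (hε : Summable ε)
    (hf : ∀ m, ‖f m‖ ≤ ε m) (k : ℕ) : ‖tailSum κ f k‖ ≤ K * ∑' m, ε m := by
  have hK : 0 ≤ K := (norm_nonneg _).trans (hκ 0)
  have hfs : Summable fun m => ‖f m‖ := hε.of_nonneg_of_le (fun _ => norm_nonneg _) hf
  refine (norm_tailSum_le hκ hfs.of_norm k).trans ?_
  refine mul_le_mul_of_nonneg_left ?_ hK
  exact Summable.tsum_le_tsum_of_inj (k + ·) (add_right_injective k)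
    (fun m _ => (norm_nonneg _).trans (hf m)) (fun j => hf (k + j))
    (summable_shift hfs k) hε

lemma tendsto_tailSum (hκ : ∀ j, ‖κ j‖ ≤ K) (hf : Summable f) :
    Tendsto (tailSum κ f) atTop (𝓝 0) := by
  refine squeeze_zero_norm (norm_tailSum_le hκ hf) ?_
  simpa only [mul_zero, add_comm] using (tendsto_sum_nat_add fun m => ‖f m‖).const_mul K

open BoundedContinuousFunction in
lemma exists_eq_one_add_tailSum (hκ : ∀ j, ‖κ j‖ ≤ K) {q : (ℕ → ℂ) →ₗ[ℂ] ℕ → ℂ} {ε : ℕ → ℝ}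
    (hε : Summable ε) (hsmall : K * ∑' m, ε m ≤ 1 / 2)
    (hq : ∀ u M, (∀ k, ‖u k‖ ≤ M) → ∀ m, ‖q u m‖ ≤ ε m * M) :
    ∃ u : ℕ → ℂ, Summable (q u) ∧ ∀ k, u k = 1 + tailSum κ (q u) k := by
  have hqs (u : ℕ →ᵇ ℂ) : Summable (q u) :=
    .of_norm_bounded (hε.mul_right ‖u‖) (hq u _ u.norm_coe_le_norm)
  have hbound (u : ℕ → ℂ) (M : ℝ) (hu : ∀ k, ‖u k‖ ≤ M) (k : ℕ) :
      ‖tailSum κ (q u) k‖ ≤ 1 / 2 * M := by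
    have hM : 0 ≤ M := (norm_nonneg _).trans (hu 0)
    refine (norm_tailSum_le_of_norm_le hκ (hε.mul_right M) (hq u M hu) k).trans ?_
    rw [tsum_mul_right, ← mul_assoc]
    gcongr
  let T (u : ℕ →ᵇ ℂ) : ℕ →ᵇ ℂ :=
    ofNormedAddCommGroupDiscrete (fun k => 1 + tailSum κ (q u) k) (1 + 1 / 2 * ‖u‖) fun k =>
      (norm_add_le _ _).trans (by rw [norm_one]; gcongr; exact hbound u _ u.norm_coe_le_norm k)
  have hT : ContractingWith (1 / 2) T := by
    refine ⟨by norm_num, LipschitzWith.of_dist_le_mul fun u v =>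
      (BoundedContinuousFunction.dist_le (by positivity)).2 fun k => ?_⟩
    have hsub : T u k - T v k = tailSum κ (q (u - v)) k := by
      rw [map_sub, ← tailSum_sub hκ (hqs u) (hqs v)]
      exact add_sub_add_left_eq_sub _ _ _
    rw [dist_eq_norm, hsub, dist_eq_norm]
    simpa using hbound (u - v) ‖u - v‖ (u - v).norm_coe_le_norm k
  exact ⟨_, hqs (hT.fixedPoint T), fun k => DFunLike.congr_fun hT.fixedPoint_isFixedPt.symm k⟩

end TailSum

/-! ### Jost solutions -/

/-- The kernel of the Volterra equation for the normalized Jost solution `z⁻ⁿ ψ(n)`. -/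
def jostKernel (α : ℝ) (z : ℂ) (j : ℕ) : ℂ := z / α * ∑ i ∈ Finset.range (j + 1), (z ^ 2) ^ i

section Jost

variable {α β : ℝ} {z : ℂ}

lemma jostKernel_zero (α : ℝ) (z : ℂ) : jostKernel α z 0 = z / α := by simp [jostKernel]

lemma jostKernel_succ (α : ℝ) (z : ℂ) (j : ℕ) :
    jostKernel α z (j + 1) = z / α + z ^ 2 * jostKernel α z j := by
  rw [jostKernel, geom_sum_succ, jostKernel]
  ring

lemma norm_jostKernel_le (α : ℝ) (hz : ‖z‖ ≤ 1) (hz2 : z ^ 2 ≠ 1) (j : ℕ) :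
    ‖jostKernel α z j‖ ≤ ‖z / α‖ * (2 / ‖z ^ 2 - 1‖) := by
  rw [jostKernel, norm_mul, geom_sum_eq hz2, norm_div (_ - 1)]
  have hpow : ‖(z ^ 2) ^ (j + 1)‖ ≤ 1 := by
    simpa only [← pow_mul, norm_pow] using pow_le_one₀ (norm_nonneg z) hz
  gcongr
  exact (norm_sub_le _ _).trans (by rw [norm_one]; linarith)

lemma tailSum_jostKernel (α : ℝ) (hz : ‖z‖ ≤ 1) (hz2 : z ^ 2 ≠ 1) {f : ℕ → ℂ} (hf : Summable f)
    (k : ℕ) : tailSum (jostKernel α z) f k =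
      z / α * ∑' j, f (k + j) + z ^ 2 * tailSum (jostKernel α z) f (k + 1) := by
  have hκ := norm_jostKernel_le α hz hz2
  have hs := summable_shift hf
  have hterm (j : ℕ) : jostKernel α z (j + 1) * f (k + (j + 1)) =
      z / α * f (k + 1 + j) + z ^ 2 * (jostKernel α z j * f (k + 1 + j)) := by
    rw [jostKernel_succ, add_comm j 1, ← add_assoc]
    ring
  rw [(hs k).tsum_eq_zero_add, tailSum, (summable_mul_shift hκ hf k).tsum_eq_zero_add,
    tsum_congr hterm, ((hs (k + 1)).mul_left _).tsum_add
      ((summable_mul_shift hκ hf (k + 1)).mul_left _), tsum_mul_left, tsum_mul_left,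
    jostKernel_zero, tailSum]
  simp only [add_comm 1, add_assoc]
  ring

/-- Convolution with `jostKernel` inverts the normalized free operator. -/
lemma jostKernel_recurrence (hα : α ≠ 0) (hz0 : z ≠ 0) (hz : ‖z‖ ≤ 1) (hz2 : z ^ 2 ≠ 1)
    {f u : ℕ → ℂ} (hf : Summable f) (hu : ∀ k, u k = 1 + tailSum (jostKernel α z) f k) (k : ℕ) :
    α * (z⁻¹ * (u k - u (k + 1)) + z * (u (k + 2) - u (k + 1))) = f k := by
  have hα' : (α : ℂ) ≠ 0 := mod_cast hα
  have h₀ := tailSum_jostKernel α hz hz2 hf k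
  have h₁ := tailSum_jostKernel α hz hz2 hf (k + 1)
  have hsplit : ∑' j, f (k + j) = f k + ∑' j, f (k + 1 + j) := by
    rw [(summable_shift hf k).tsum_eq_zero_add]
    simp only [add_zero, add_assoc, add_comm 1]
  rw [hsplit] at h₀
  rw [hu k, hu (k + 1), hu (k + 2)]
  rw [add_assoc k 1 1, one_add_one_eq_two] at h₁
  field_simp at h₀ h₁ ⊢
  linear_combination h₀ - h₁

/-- The perturbation term of the difference equation satisfied by `z⁻ⁿ ψ(n)`, `n ≥ N`. -/
def jostPerturbation (a b : ℤ → ℝ) (α β : ℝ) (z : ℂ) (N : ℕ) : (ℕ → ℂ) →ₗ[ℂ] ℕ → ℂ where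
  toFun u m := (α - a (m + N : ℕ)) * z⁻¹ * u m + (β - b (m + N + 1 : ℕ)) * u (m + 1) +
    (α - a (m + N + 1 : ℕ)) * z * u (m + 2)
  map_add' u v := by
    ext m
    simp only [Pi.add_apply]
    ring
  map_smul' r u := by
    ext m
    simp only [Pi.smul_apply, smul_eq_mul, RingHom.id_apply]
    ring

/-- A majorant of the coefficients of `jostPerturbation`, whose coefficients at `m` are bounded by
`jostWeight` at `m + N`. -/
def jostWeight (a b : ℤ → ℝ) (α β : ℝ) (z : ℂ) (m : ℕ) : ℝ :=
  |a m - α| * ‖z⁻¹‖ + |b (m + 1 : ℕ) - β| + |a (m + 1 : ℕ) - α| * ‖z‖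

lemma norm_jostPerturbation_le (a b : ℤ → ℝ) (α β : ℝ) (z : ℂ) (N : ℕ) (u : ℕ → ℂ) (M : ℝ)
    (hu : ∀ k, ‖u k‖ ≤ M) (m : ℕ) :
    ‖jostPerturbation a b α β z N u m‖ ≤ jostWeight a b α β z (m + N) * M := by
  have hnorm (x y : ℝ) : ‖(x : ℂ) - y‖ = |y - x| := by
    rw [← Complex.ofReal_sub, Complex.norm_real, Real.norm_eq_abs, abs_sub_comm]
  refine norm_add₃_le.trans ?_
  simp only [norm_mul, hnorm, jostWeight, add_mul]
  gcongr <;> exact hu _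

variable {a b : ℤ → ℝ}

lemma summable_jostWeight (hsa : Summable fun n : ℕ => |a n - α|)
    (hsb : Summable fun n : ℕ => |b n - β|) (z : ℂ) : Summable (jostWeight a b α β z) :=
  ((hsa.mul_right _).add ((summable_nat_add_iff 1).2 hsb)).add
    (((summable_nat_add_iff 1).2 hsa).mul_right _)

lemma exists_normalized_jost (hα : α ≠ 0) (hsa : Summable fun n : ℕ => |a n - α|)
    (hsb : Summable fun n : ℕ => |b n - β|) (hz0 : z ≠ 0) (hz : ‖z‖ ≤ 1) (hz2 : z ^ 2 ≠ 1) :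
    ∃ (N : ℕ) (u : ℕ → ℂ), Tendsto u atTop (𝓝 1) ∧
      ∀ k, α * (z⁻¹ * (u k - u (k + 1)) + z * (u (k + 2) - u (k + 1))) =
        jostPerturbation a b α β z N u k := by
  have hκ := norm_jostKernel_le α hz hz2
  have hw := summable_jostWeight hsa hsb z
  obtain ⟨N, hN⟩ : ∃ N, ‖z / α‖ * (2 / ‖z ^ 2 - 1‖) * ∑' m, jostWeight a b α β z (m + N) ≤ 1 / 2 :=
    (((tendsto_sum_nat_add _).const_mul _).eventually_le_const (by norm_num)).exists
  obtain ⟨u, hsum, hu⟩ := exists_eq_one_add_tailSum hκ ((summable_nat_add_iff N).2 hw) hN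
    (norm_jostPerturbation_le a b α β z N)
  refine ⟨N, u, ?_, jostKernel_recurrence hα hz0 hz hz2 hsum hu⟩
  rw [funext hu]
  simpa using (tendsto_tailSum hκ hsum).const_add 1

lemma jost_equation_of_normalized (hz0 : z ≠ 0) {N k : ℕ} {u : ℕ → ℂ}
    (hu : α * (z⁻¹ * (u k - u (k + 1)) + z * (u (k + 2) - u (k + 1))) =
      jostPerturbation a b α β z N u k) {n : ℤ} (hn : n = N + k + 1) :
    a (n - 1) * (z ^ (n - 1) * u k) + b n * (z ^ n * u (k + 1)) +
      a n * (z ^ (n + 1) * u (k + 2)) = (β + α * (z + z⁻¹)) * (z ^ n * u (k + 1)) := by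
  simp only [jostPerturbation, LinearMap.coe_mk, AddHom.coe_mk] at hu
  rw [show ((k + N : ℕ) : ℤ) = n - 1 by lia, show ((k + N + 1 : ℕ) : ℤ) = n by lia] at hu
  rw [zpow_sub_one₀ hz0, zpow_add_one₀ hz0]
  linear_combination z ^ n * hu

theorem exists_jost (ha : ∀ n, a n ≠ 0) (hα : α ≠ 0) (hsa : Summable fun n : ℕ => |a n - α|)
    (hsb : Summable fun n : ℕ => |b n - β|) (hz0 : z ≠ 0) (hz : ‖z‖ ≤ 1) (hz2 : z ^ 2 ≠ 1) :
    ∃ ψ, IsJacobiSolution a b (β + α * (z + z⁻¹)) ψ ∧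
      Tendsto (fun n : ℤ => z ^ (-n) * ψ n) atTop (𝓝 1) := by
  obtain ⟨N, u, hlim, hrec⟩ := exists_normalized_jost hα hsa hsb hz0 hz hz2
  let φ (n : ℤ) : ℂ := z ^ n * u (n - N).toNat
  refine ⟨backwardExtension a b (β + α * (z + z⁻¹)) N φ,
    isJacobiSolution_backwardExtension ha fun n hn => ?_, ?_⟩
  · obtain ⟨k, hk⟩ := Int.eq_ofNat_of_zero_le (show 0 ≤ n - N - 1 by lia)
    have hn' : n = N + k + 1 := by lia
    simp only [φ, show (n - 1 - N).toNat = k by lia, show (n - N).toNat = k + 1 by lia,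
      show (n + 1 - N).toNat = k + 2 by lia]
    exact jost_equation_of_normalized hz0 (hrec k) hn'
  · have hshift : Tendsto (fun n : ℤ => (n - N).toNat) atTop atTop := by
      refine tendsto_atTop.2 fun m => ?_
      filter_upwards [eventually_ge_atTop ((N : ℤ) + m)] with n hn
      lia
    refine (hlim.comp hshift).congr' ?_
    filter_upwards [eventually_ge_atTop (N : ℤ)] with n hn
    rw [backwardExtension_of_le a b _ φ hn, ← mul_assoc, ← zpow_add₀ hz0, neg_add_cancel,
      zpow_zero, one_mul, Function.comp_apply]

end Jost

/-! ### Wronskians of Jost solutions -/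

section JostWronskian

variable {a b : ℤ → ℝ} {α x : ℝ} {z : ℂ} {ψ : ℤ → ℂ}

lemma tendsto_comp_sub_one {X : Type*} {l : Filter X} {u : ℤ → X} (h : Tendsto u atTop l) :
    Tendsto (fun n => u (n - 1)) atTop l :=
  h.comp (tendsto_atTop_add_const_right atTop (-1) tendsto_id)

lemma tendsto_ofReal_comp_sub_one (ha : Tendsto a atTop (𝓝 α)) :
    Tendsto (fun n => (a (n - 1) : ℂ)) atTop (𝓝 α) :=
  (Complex.continuous_ofReal.tendsto α).comp (tendsto_comp_sub_one ha)

lemma tendsto_zpow_atTop_nhds_zero_of_norm_lt_one (hz : ‖z‖ < 1) :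
    Tendsto (fun n : ℤ => z ^ n) atTop (𝓝 0) := by
  have hnat : Tendsto Int.toNat atTop atTop := tendsto_atTop.2 fun m => by
    filter_upwards [eventually_ge_atTop (m : ℤ)] with n hn
    lia
  refine ((tendsto_pow_atTop_nhds_zero_of_norm_lt_one hz).comp hnat).congr' ?_
  filter_upwards [eventually_ge_atTop 0] with n hn
  rw [Function.comp_apply, ← zpow_natCast, Int.toNat_of_nonneg hn]

lemma exists_ne_zero_of_tendsto_jost (hl : Tendsto (fun n : ℤ => z ^ (-n) * ψ n) atTop (𝓝 1)) :
    ∃ n, ψ n ≠ 0 := by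
  by_contra! h
  simp only [h, mul_zero] at hl
  exact zero_ne_one (tendsto_nhds_unique tendsto_const_nhds hl)

lemma wronskian_conj_of_norm_eq_one (ha : Tendsto a atTop (𝓝 α)) (hz : ‖z‖ = 1)
    (hψ : IsJacobiSolution a b x ψ) (hl : Tendsto (fun n : ℤ => z ^ (-n) * ψ n) atTop (𝓝 1))
    (n : ℤ) : wronskian a ψ (fun k => conj (ψ k)) n = α * (z⁻¹ - z) := by
  refine hψ.wronskian_eq_of_tendsto hψ.conj ?_ n
  have hz0 : z ≠ 0 := norm_ne_zero_iff.1 (hz ▸ one_ne_zero)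
  have hconj : conj z = z⁻¹ := (Complex.inv_eq_conj hz).symm
  have hl' := (Complex.continuous_conj.tendsto 1).comp hl
  have hlim := (tendsto_ofReal_comp_sub_one ha).mul
    ((((tendsto_comp_sub_one hl).mul hl').const_mul z⁻¹).sub
      ((hl.mul (tendsto_comp_sub_one hl')).const_mul z))
  simp only [map_one, mul_one] at hlim
  refine hlim.congr fun k => ?_
  have hzk : z ^ k ≠ 0 := zpow_ne_zero _ hz0
  simp only [wronskian, Function.comp_apply, map_mul, map_zpow₀, hconj]
  rw [show -(k - 1) = -k + 1 by ring, zpow_add_one₀ hz0, zpow_add_one₀ (inv_ne_zero hz0)]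
  simp only [_root_.zpow_neg, _root_.inv_zpow, inv_inv]
  field_simp

lemma wronskian_conj_of_norm_lt_one (ha : Tendsto a atTop (𝓝 α)) (hz0 : z ≠ 0) (hz : ‖z‖ < 1)
    (hψ : IsJacobiSolution a b x ψ) (hl : Tendsto (fun n : ℤ => z ^ (-n) * ψ n) atTop (𝓝 1))
    (n : ℤ) : wronskian a ψ (fun k => conj (ψ k)) n = 0 := by
  refine hψ.wronskian_eq_of_tendsto hψ.conj ?_ n
  have h0 : Tendsto ψ atTop (𝓝 0) := by
    have hmul := (tendsto_zpow_atTop_nhds_zero_of_norm_lt_one hz).mul hl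
    rw [zero_mul] at hmul
    refine hmul.congr fun k => ?_
    rw [← mul_assoc, ← zpow_add₀ hz0, add_neg_cancel, zpow_zero, one_mul]
  have h0' := (Complex.continuous_conj.tendsto 0).comp h0
  rw [map_zero] at h0'
  have hlim := (tendsto_ofReal_comp_sub_one ha).mul
    (((tendsto_comp_sub_one h0).mul h0').sub (h0.mul (tendsto_comp_sub_one h0')))
  simp only [mul_zero, sub_zero] at hlim
  exact hlim

end JostWronskian

section RealSolution

variable {a b : ℤ → ℝ} {x : ℝ} {ψ φ : ℤ → ℂ}

lemma norm_wronskian_conj_eq_norm_wronskian {n : ℤ} (ψ : ℤ → ℂ)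
    (hφ : wronskian a φ (fun k => conj (φ k)) n = 0) :
    ‖wronskian a φ (fun k => conj (ψ k)) n‖ = ‖wronskian a ψ φ n‖ := by
  set A := wronskian a φ (fun k => conj (ψ k)) n with hA
  set B := wronskian a ψ φ n with hB
  have hmul : A * conj A = B * conj B := by
    rw [hA, hB]
    simp only [wronskian, map_mul, map_sub, Complex.conj_conj, Complex.conj_ofReal] at hφ ⊢
    linear_combination (a (n - 1) * (ψ (n - 1) * conj (ψ n) - ψ n * conj (ψ (n - 1)))) * (-hφ)
  rw [Complex.mul_conj', Complex.mul_conj'] at hmul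
  exact (pow_left_inj₀ (norm_nonneg _) (norm_nonneg _) two_ne_zero).1 (mod_cast hmul)

lemma wronskian_ne_zero_of_wronskian_conj_eq_zero (hψ : IsJacobiSolution a b x ψ)
    (hφ : IsJacobiSolution a b x φ) {n : ℤ} (hψw : wronskian a ψ (fun k => conj (ψ k)) n ≠ 0)
    (hφw : wronskian a φ (fun k => conj (φ k)) n = 0) (hφ0 : ∃ k, φ k ≠ 0) :
    wronskian a ψ φ n ≠ 0 := by
  intro hB
  have hA : wronskian a φ (fun k => conj (ψ k)) n = 0 := by
    rw [← norm_eq_zero, norm_wronskian_conj_eq_norm_wronskian ψ hφw, hB, norm_zero]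
  obtain ⟨k, hk⟩ := hφ0
  refine mul_ne_zero hψw hk ?_
  rw [hψ.wronskian_eq hψ.conj n k, wronskian_mul_eq, hφ.wronskian_eq hψ.conj k n,
    hψ.wronskian_eq hφ k n, hA, hB, zero_mul, zero_mul, add_zero]

end RealSolution

/-! ### Holomorphic functions on the upper half-plane with boundary values -/

local notation "ℍₒ" => UpperHalfPlane.upperHalfPlaneSet

section RealLine

variable {f : ℂ → ℂ}

lemma wedgeIntegral_eq_neg_of_differentiableOn_off_real {z w : ℂ}
    (hc : ContinuousOn f (Complex.Rectangle z w))
    (hd : DifferentiableOn ℂ f (Complex.Rectangle z w \ {ζ | ζ.im = 0})) :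
    Complex.wedgeIntegral z w f = -Complex.wedgeIntegral w z f := by
  rw [eq_neg_iff_add_eq_zero, Complex.wedgeIntegral_add_wedgeIntegral_eq]
  have rect_eq_zero : ∀ r s : ℝ, Set.uIcc r s ⊆ Set.uIcc z.im w.im →
      (∀ y ∈ Set.Ioo (min r s) (max r s), y ≠ 0) →
      (∫ x : ℝ in z.re..w.re, f (x + r * Complex.I)) -
        (∫ x : ℝ in z.re..w.re, f (x + s * Complex.I)) +
        Complex.I • (∫ y : ℝ in r..s, f (w.re + y * Complex.I)) -
        Complex.I • (∫ y : ℝ in r..s, f (z.re + y * Complex.I)) = 0 := by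
    intro r s hrs h0
    refine Complex.integral_boundary_rect_eq_zero_of_continuousOn_of_differentiableOn f
      ⟨z.re, r⟩ ⟨w.re, s⟩ (hc.mono (Set.inter_subset_inter_right _ (Set.preimage_mono hrs)))
      (hd.mono fun ζ hζ => ⟨⟨Set.Ioo_subset_Icc_self hζ.1, hrs (Set.Ioo_subset_Icc_self hζ.2)⟩,
        h0 _ hζ.2⟩)
  by_cases h0 : (0 : ℝ) ∈ Set.uIcc z.im w.im
  · have integrable : ∀ x ∈ Set.uIcc z.re w.re, ∀ r ∈ Set.uIcc z.im w.im,
        ∀ s ∈ Set.uIcc z.im w.im,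
        IntervalIntegrable (fun y : ℝ => f (x + y * Complex.I)) MeasureTheory.volume r s :=
      fun x hx r hr s hs => (hc.comp (by fun_prop) fun y hy =>
        ⟨by simpa using hx, by simpa using Set.uIcc_subset_uIcc hr hs hy⟩).intervalIntegrable
    have split : ∀ x ∈ Set.uIcc z.re w.re, ∫ y : ℝ in z.im..w.im, f (x + y * Complex.I) =
        (∫ y : ℝ in z.im..0, f (x + y * Complex.I)) +
          ∫ y : ℝ in 0..w.im, f (x + y * Complex.I) := fun x hx =>
      (intervalIntegral.integral_add_adjacent_intervals
        (integrable x hx _ Set.left_mem_uIcc _ h0)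
        (integrable x hx _ h0 _ Set.right_mem_uIcc)).symm
    have lower := rect_eq_zero z.im 0 (Set.uIcc_subset_uIcc Set.left_mem_uIcc h0) (by grind)
    have upper := rect_eq_zero 0 w.im (Set.uIcc_subset_uIcc h0 Set.right_mem_uIcc) (by grind)
    rw [split _ Set.left_mem_uIcc, split _ Set.right_mem_uIcc, smul_add, smul_add]
    linear_combination lower + upper
  · exact rect_eq_zero _ _ subset_rfl fun y hy hy0 => h0 (hy0 ▸ Set.Ioo_subset_Icc_self hy)

/-- Painlevé's theorem for the real line. -/
theorem differentiableOn_of_continuousOn_of_differentiableOn_off_real {U : Set ℂ} (hU : IsOpen U)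
    (hc : ContinuousOn f U) (hd : DifferentiableOn ℂ f (U \ {z | z.im = 0})) :
    DifferentiableOn ℂ f U :=
  (Complex.isConservativeOn_and_continuousOn_iff_isDifferentiableOn hU).1
    ⟨fun _ _ hzw => wedgeIntegral_eq_neg_of_differentiableOn_off_real (hc.mono hzw)
      (hd.mono (Set.sdiff_subset_sdiff_left hzw)), hc⟩

end RealLine

lemma ofReal_mem_closure_upperHalfPlaneSet (x : ℝ) : (x : ℂ) ∈ closure ℍₒ := by
  simp [Complex.closure_setOfPred_lt_im]

instance neBot_nhdsWithin_upperHalfPlaneSet (x : ℝ) : (𝓝[ℍₒ] (x : ℂ)).NeBot :=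
  mem_closure_iff_nhdsWithin_neBot.1 (ofReal_mem_closure_upperHalfPlaneSet x)

lemma tendsto_ofReal_add_mul_I (x : ℝ) :
    Tendsto (fun y : ℝ => (x : ℂ) + y * Complex.I) (𝓝[>] 0) (𝓝[ℍₒ] (x : ℂ)) := by
  refine tendsto_nhdsWithin_iff.2 ⟨?_, ?_⟩
  · exact (Continuous.tendsto' (by fun_prop) _ _ (by simp)).mono_left nhdsWithin_le_nhds
  · filter_upwards [self_mem_nhdsWithin] with y hy
    simpa using hy

/-- `φ` is holomorphic on the upper half-plane, with limit `φ₀ x` at every real `x`. -/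
structure HasBoundaryValues (φ : ℂ → ℂ) (φ₀ : ℝ → ℂ) : Prop where
  differentiableOn : DifferentiableOn ℂ φ ℍₒ
  tendsto : ∀ x : ℝ, Tendsto φ (𝓝[ℍₒ] (x : ℂ)) (𝓝 (φ₀ x))

namespace HasBoundaryValues

variable {φ : ℂ → ℂ} {φ₀ : ℝ → ℂ}

lemma continuousOn_extendFrom (h : HasBoundaryValues φ φ₀) :
    ContinuousOn (extendFrom ℍₒ φ) {z : ℂ | 0 ≤ z.im} := by
  refine _root_.continuousOn_extendFrom (Complex.closure_setOfPred_lt_im 0).ge fun z hz => ?_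
  rcases (show (0 : ℝ) ≤ z.im from hz).lt_or_eq with hz | hz
  · exact ⟨φ z, h.differentiableOn.continuousOn z hz⟩
  · lift z to ℝ using hz.symm
    exact ⟨_, h.tendsto _⟩

lemma extendFrom_of_mem (h : HasBoundaryValues φ φ₀) {z : ℂ} (hz : z ∈ ℍₒ) :
    extendFrom ℍₒ φ z = φ z :=
  extendFrom_extends h.differentiableOn.continuousOn z hz

lemma extendFrom_ofReal (h : HasBoundaryValues φ φ₀) (x : ℝ) : extendFrom ℍₒ φ x = φ₀ x :=
  extendFrom_eq (ofReal_mem_closure_upperHalfPlaneSet x) (h.tendsto x)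

lemma continuous (h : HasBoundaryValues φ φ₀) : Continuous φ₀ := by
  have : Continuous fun x : ℝ => extendFrom ℍₒ φ x :=
    h.continuousOn_extendFrom.comp_continuous Complex.continuous_ofReal fun _ => by simp
  simpa only [h.extendFrom_ofReal] using this

lemma exists_bound_of_norm_le (h : HasBoundaryValues φ φ₀) (r : ℝ) :
    ∃ M, ∀ z ∈ ℍₒ, ‖z‖ ≤ r → ‖φ z‖ ≤ M := by
  have hc : IsCompact (Metric.closedBall 0 r ∩ {z : ℂ | 0 ≤ z.im}) :=
    (isCompact_closedBall _ _).inter_right (isClosed_le continuous_const Complex.continuous_im)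
  obtain ⟨M, hM⟩ := hc.exists_bound_of_continuousOn
    (h.continuousOn_extendFrom.mono Set.inter_subset_right)
  refine ⟨M, fun z hz hzr => ?_⟩
  simpa only [h.extendFrom_of_mem hz] using
    hM z ⟨by simpa using hzr, (show 0 < z.im from hz).le⟩

lemma differentiableOn_extension_by_zero (h : HasBoundaryValues φ φ₀) {U : Set ℂ} (hU : IsOpen U)
    (h0 : ∀ x : ℝ, (x : ℂ) ∈ U → φ₀ x = 0) :
    DifferentiableOn ℂ (fun z => if 0 ≤ z.im then extendFrom ℍₒ φ z else 0) U := by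
  refine differentiableOn_of_continuousOn_of_differentiableOn_off_real hU
    (ContinuousOn.if ?_ ?_ continuousOn_const) fun z hz => ?_
  · rintro z ⟨hzU, hz⟩
    rw [Complex.frontier_setOfPred_le_im, Set.mem_ofPred_eq] at hz
    lift z to ℝ using hz
    rw [h.extendFrom_ofReal, h0 _ hzU]
  · rw [(isClosed_le continuous_const Complex.continuous_im).closure_eq]
    exact h.continuousOn_extendFrom.mono Set.inter_subset_right
  · refine DifferentiableAt.differentiableWithinAt ?_
    rcases lt_or_gt_of_ne hz.2 with hneg | hpos
    · refine (differentiableAt_const (0 : ℂ)).congr_of_eventuallyEq ?_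
      filter_upwards [(isOpen_lt Complex.continuous_im continuous_const).mem_nhds hneg] with w hw
      exact if_neg (not_le.2 hw)
    · have hmem := UpperHalfPlane.isOpen_upperHalfPlaneSet.mem_nhds hpos
      refine (h.differentiableOn.differentiableAt hmem).congr_of_eventuallyEq ?_
      filter_upwards [hmem] with w hw
      rw [if_pos (show 0 < w.im from hw).le, h.extendFrom_of_mem hw]

theorem eqOn_zero_of_boundary_eq_zero (h : HasBoundaryValues φ φ₀) {p q : ℝ} (hpq : p < q)
    (h0 : ∀ x ∈ Set.Ioo p q, φ₀ x = 0) : Set.EqOn φ 0 ℍₒ := by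
  set U : Set ℂ := Complex.re ⁻¹' Set.Ioo p q with hU
  have hUo : IsOpen U := isOpen_Ioo.preimage Complex.continuous_re
  have hUc : IsPreconnected U :=
    ((convex_Ioo p q).linear_preimage Complex.reLm).isPreconnected
  set F : ℂ → ℂ := fun z => if 0 ≤ z.im then extendFrom ℍₒ φ z else 0 with hF
  have analytic : AnalyticOnNhd ℂ F U :=
    (h.differentiableOn_extension_by_zero hUo fun x hx => h0 x hx).analyticOnNhd hUo
  obtain ⟨x, hx⟩ := Set.nonempty_Ioo.2 hpq
  have below : F =ᶠ[𝓝 ((x : ℂ) - Complex.I)] 0 := by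
    filter_upwards [(isOpen_lt Complex.continuous_im continuous_const).mem_nhds
      (show ((x : ℂ) - Complex.I).im < 0 by simp)] with w hw
    exact if_neg (not_le.2 hw)
  have vanish : Set.EqOn F 0 U :=
    analytic.eqOn_zero_of_preconnected_of_eventuallyEq_zero hUc (by simpa [hU] using hx) below
  refine (h.differentiableOn.analyticOnNhd
    UpperHalfPlane.isOpen_upperHalfPlaneSet).eqOn_zero_of_preconnected_of_eventuallyEq_zero
    (convex_halfSpace_im_gt 0).isPreconnected (z₀ := x + Complex.I) (by simp) ?_
  filter_upwards [hUo.mem_nhds (show (x + Complex.I : ℂ) ∈ U by simpa [hU] using hx),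
    UpperHalfPlane.isOpen_upperHalfPlaneSet.mem_nhds
      (show (x + Complex.I : ℂ) ∈ ℍₒ by simp)] with w hwU hw
  simpa only [hF, if_pos (show 0 < w.im from hw).le, h.extendFrom_of_mem hw] using vanish hwU

end HasBoundaryValues

/-! ### Integrals of boundary values -/

section BoundaryIntegral

open MeasureTheory Asymptotics Bornology

lemma tendsto_intervalIntegral_zero_of_norm_le {F : ℝ → ℝ → ℂ} {u v : ℝ → ℝ} {C K : ℝ}
    (hF : ∀ᶠ R in atTop, ∀ x ∈ Set.uIoc (u R) (v R), ‖F R x‖ ≤ C / R ^ 2)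
    (hK : ∀ᶠ R in atTop, |v R - u R| ≤ K * R) :
    Tendsto (fun R => ∫ x in u R..v R, F R x) atTop (𝓝 0) := by
  refine squeeze_zero_norm' (a := fun R => |C| * K * R⁻¹) ?_
    (by simpa using tendsto_inv_atTop_zero.const_mul (|C| * K))
  filter_upwards [hF, hK, eventually_gt_atTop 0] with R hFR hKR hR
  calc ‖∫ x in u R..v R, F R x‖
      ≤ |C| / R ^ 2 * |v R - u R| :=
        intervalIntegral.norm_integral_le_of_norm_le_const fun x hx =>
          (hFR x hx).trans (by gcongr; exact le_abs_self C)
    _ ≤ |C| / R ^ 2 * (K * R) := by gcongr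
    _ = |C| * K * R⁻¹ := by field_simp

variable {G : ℂ → ℂ}

lemma exists_norm_le_div_sq_of_isBigO
    (hG : G =O[cobounded ℂ ⊓ 𝓟 ℍₒ] fun z => (z ^ 2)⁻¹) :
    ∃ C : ℝ, ∀ᶠ R : ℝ in atTop, ∀ z ∈ ℍₒ, R ≤ ‖z‖ → ‖G z‖ ≤ C / R ^ 2 := by
  obtain ⟨C, hC0, hC⟩ := hG.exists_nonneg
  rw [IsBigOWith, eventually_inf_principal, ← comap_norm_atTop, eventually_comap] at hC
  obtain ⟨R₀, hR₀⟩ := eventually_atTop.1 hC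
  refine ⟨C, ?_⟩
  filter_upwards [eventually_ge_atTop R₀, eventually_gt_atTop 0] with R hR hR0 z hz hzR
  calc ‖G z‖ ≤ C * ‖(z ^ 2)⁻¹‖ := hR₀ _ (hR.trans hzR) z rfl hz
    _ = C / ‖z‖ ^ 2 := by rw [norm_inv, norm_pow, div_eq_mul_inv]
    _ ≤ C / R ^ 2 := by gcongr

theorem integral_horizontal_line_eq_zero (hG : DifferentiableOn ℂ G ℍₒ)
    (hdecay : G =O[cobounded ℂ ⊓ 𝓟 ℍₒ] fun z => (z ^ 2)⁻¹) {y : ℝ} (hy : 0 < y)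
    (hint : Integrable fun x : ℝ => G (x + y * Complex.I)) :
    ∫ x : ℝ, G (x + y * Complex.I) = 0 := by
  obtain ⟨C, hC⟩ := exists_norm_le_div_sq_of_isBigO hdecay
  have top : Tendsto (fun R : ℝ => ∫ x in (-R)..R, G (x + R * Complex.I)) atTop (𝓝 0) := by
    refine tendsto_intervalIntegral_zero_of_norm_le (C := C) (K := 2) ?_ ?_
    · filter_upwards [hC, eventually_gt_atTop 0] with R hR hR0 x _
      refine hR _ (by simpa using hR0) ?_
      simpa [abs_of_pos hR0] using Complex.abs_im_le_norm ((x : ℂ) + R * Complex.I)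
    · filter_upwards [eventually_ge_atTop 0] with R hR
      rw [abs_of_nonneg (by linarith)]
      linarith
  have side : ∀ s : ℝ → ℝ, (∀ R, |s R| = |R|) →
      Tendsto (fun R : ℝ => ∫ v in y..R, G (s R + v * Complex.I)) atTop (𝓝 0) := by
    intro s hs
    refine tendsto_intervalIntegral_zero_of_norm_le (C := C) (K := 1) ?_ ?_
    · filter_upwards [hC, eventually_ge_atTop y] with R hR hyR v hv
      rw [Set.uIoc_of_le hyR] at hv
      refine hR _ (by simpa using hy.trans hv.1) ?_
      simpa [hs, abs_of_pos (hy.trans_le hyR)] using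
        Complex.abs_re_le_norm ((s R : ℂ) + v * Complex.I)
    · filter_upwards [eventually_ge_atTop y] with R hyR
      rw [abs_of_nonneg (by linarith)]
      linarith
  have rectangle : ∀ᶠ R : ℝ in atTop, (∫ x in (-R)..R, G (x + R * Complex.I)) -
      Complex.I * (∫ v in y..R, G ((R : ℝ) + v * Complex.I)) +
      Complex.I * (∫ v in y..R, G ((-R : ℝ) + v * Complex.I)) =
        ∫ x in (-R)..R, G (x + y * Complex.I) := by
    filter_upwards [eventually_ge_atTop y] with R hyR
    have := Complex.integral_boundary_rect_eq_zero_of_differentiableOn G ⟨-R, y⟩ ⟨R, R⟩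
      (hG.mono fun z hz => hy.trans_le (by simpa [hyR] using hz.2.1))
    simp only [smul_eq_mul] at this
    linear_combination -this
  have hlim := ((top.sub ((side id fun _ => rfl).const_mul Complex.I)).add
    ((side (fun R => -R) abs_neg).const_mul Complex.I)).congr' rectangle
  simpa using tendsto_nhds_unique
    (intervalIntegral_tendsto_integral hint tendsto_neg_atTop_atBot tendsto_id) hlim

theorem integral_boundary_eq_zero {G₀ : ℝ → ℂ} {h : ℝ → ℝ} (hG : DifferentiableOn ℂ G ℍₒ)
    (hdecay : G =O[cobounded ℂ ⊓ 𝓟 ℍₒ] fun z => (z ^ 2)⁻¹) (hh : Integrable h)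
    (hdom : ∀ᵐ x : ℝ, ∀ y : ℝ, 0 < y → ‖G (x + y * Complex.I)‖ ≤ h x)
    (hlim : ∀ᵐ x : ℝ, Tendsto G (𝓝[ℍₒ] (x : ℂ)) (𝓝 (G₀ x))) :
    Integrable G₀ ∧ ∫ x, G₀ x = 0 := by
  have hmeas : ∀ᶠ y : ℝ in 𝓝[>] 0,
      AEStronglyMeasurable fun x : ℝ => G (x + y * Complex.I) := by
    filter_upwards [self_mem_nhdsWithin] with y hy
    exact (hG.continuousOn.comp_continuous (by fun_prop)
      fun x => by simpa using hy).aestronglyMeasurable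
  have hbound : ∀ᶠ y : ℝ in 𝓝[>] 0, ∀ᵐ x : ℝ, ‖G (x + y * Complex.I)‖ ≤ h x := by
    filter_upwards [self_mem_nhdsWithin] with y hy
    exact hdom.mono fun x hx => hx y hy
  have hvert : ∀ᵐ x : ℝ, Tendsto (fun y : ℝ => G (x + y * Complex.I)) (𝓝[>] 0) (𝓝 (G₀ x)) :=
    hlim.mono fun x hx => hx.comp (tendsto_ofReal_add_mul_I x)
  have hzero : ∀ᶠ y : ℝ in 𝓝[>] 0, 0 = ∫ x : ℝ, G (x + y * Complex.I) := by
    filter_upwards [self_mem_nhdsWithin, hmeas, hbound] with y hy hm hb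
    exact (integral_horizontal_line_eq_zero hG hdecay hy (hh.mono' hm hb)).symm
  obtain ⟨y, hy⟩ := exists_seq_tendsto (𝓝[>] (0 : ℝ))
  refine ⟨hh.mono' ?_ ?_, tendsto_nhds_unique
    (tendsto_integral_filter_of_dominated_convergence h hmeas hbound hh hvert)
    (tendsto_const_nhds.congr' hzero)⟩
  · obtain ⟨N, hN⟩ := eventually_atTop.1 (hy.eventually hmeas)
    exact aestronglyMeasurable_of_tendsto_ae atTop (fun n : ℕ => hN (n + N) (Nat.le_add_left N n))
      (hvert.mono fun x hx => hx.comp ((tendsto_add_atTop_iff_nat N).2 hy))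
  · filter_upwards [hdom, hvert] with x hx hx'
    exact le_of_tendsto hx'.norm (eventually_mem_nhdsWithin.mono fun y hy => hx y hy)

end BoundaryIntegral

/-! ### The background root -/

section Sqrt

lemma sqrt_sq (w : ℂ) : Complex.sqrt w ^ 2 = w := by
  simpa only [Complex.sqrt, Nat.cast_ofNat] using Complex.cpow_nat_inv_pow w two_ne_zero

lemma norm_sqrt (w : ℂ) : ‖Complex.sqrt w‖ = √‖w‖ := by
  rw [← Real.sqrt_sq (norm_nonneg (Complex.sqrt w)), ← norm_pow, sqrt_sq]

lemma continuousOn_sqrt : ContinuousOn Complex.sqrt {z : ℂ | 0 ≤ z.im} := by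
  have : Continuous fun a : ℂ =>
      (√((‖a‖ + a.re) / 2) : ℂ) + √((‖a‖ - a.re) / 2) * Complex.I := by fun_prop
  refine this.continuousOn.congr fun a ha => ?_
  rw [Complex.sqrt_eq_real_add_ite, if_pos (show 0 ≤ a.im from ha), one_mul]

open ComplexOrder in
lemma sqrt_ofReal_of_nonneg {s : ℝ} (hs : 0 ≤ s) : Complex.sqrt s = √s := by
  rw [Complex.sqrt_of_nonneg (by exact_mod_cast hs), Complex.ofReal_re]

open ComplexOrder in
lemma sqrt_ofReal_of_nonpos {s : ℝ} (hs : s ≤ 0) : Complex.sqrt s = Complex.I * √(-s) := by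
  have := Complex.sqrt_neg_of_nonneg (a := ((-s : ℝ) : ℂ)) (by exact_mod_cast neg_nonneg.2 hs)
  rw [sqrt_ofReal_of_nonneg (neg_nonneg.2 hs)] at this
  simpa using this

end Sqrt

section CutRoot

variable {α β x : ℝ}

lemma cutRoot_sq (α β : ℝ) (z : ℂ) : cutRoot α β z ^ 2 = (z - β) ^ 2 - 4 * α ^ 2 := by
  rw [cutRoot, mul_pow, sqrt_sq, sqrt_sq]
  ring

lemma norm_cutRoot (α β : ℝ) (z : ℂ) :
    ‖cutRoot α β z‖ = √‖z - (β + 2 * α : ℝ)‖ * √‖z - (β - 2 * α : ℝ)‖ := by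
  rw [cutRoot, norm_mul, norm_sqrt, norm_sqrt]
  push_cast
  congr 3 <;> ring_nf

lemma cutRoot_ne_zero {z : ℂ} (h₁ : z ≠ (β + 2 * α : ℝ)) (h₂ : z ≠ (β - 2 * α : ℝ)) :
    cutRoot α β z ≠ 0 := by
  rw [← norm_ne_zero_iff, norm_cutRoot]
  have := sub_ne_zero.2 h₁
  have := sub_ne_zero.2 h₂
  positivity

lemma cutRoot_ne_zero_of_mem_upperHalfPlaneSet {z : ℂ} (hz : z ∈ ℍₒ) : cutRoot α β z ≠ 0 :=
  have ne_ofReal : ∀ e : ℝ, z ≠ e := by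
    rintro e rfl
    simp at hz
  cutRoot_ne_zero (ne_ofReal _) (ne_ofReal _)

lemma differentiableOn_cutRoot (α β : ℝ) : DifferentiableOn ℂ (cutRoot α β) ℍₒ := by
  have sqrt_comp : ∀ g : ℂ → ℂ, Differentiable ℂ g → (∀ z, (g z).im = z.im) →
      DifferentiableOn ℂ (fun z => Complex.sqrt (g z)) ℍₒ := fun g hg him z hz =>
    ((Complex.differentiableAt_sqrt (Or.inr ((him z).trans_ne (ne_of_gt hz)))).comp z
      (hg z)).differentiableWithinAt
  exact (sqrt_comp _ (by fun_prop) (by simp)).mul (sqrt_comp _ (by fun_prop) (by simp))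

lemma tendsto_cutRoot (α β x : ℝ) :
    Tendsto (cutRoot α β) (𝓝[ℍₒ] (x : ℂ)) (𝓝 (cutRoot α β x)) := by
  have hc : ContinuousOn (cutRoot α β) {z : ℂ | 0 ≤ z.im} :=
    (continuousOn_sqrt.comp (by fun_prop) fun z hz => by simpa using hz).mul
      (continuousOn_sqrt.comp (by fun_prop) fun z hz => by simpa using hz)
  exact (hc x (by simp)).mono_left (nhdsWithin_mono _ fun z hz => (show 0 < z.im from hz).le)

open Asymptotics Bornology in
lemma inv_cutRoot_isBigO (α β : ℝ) :
    (fun z => (cutRoot α β z)⁻¹) =O[cobounded ℂ] fun z : ℂ => z⁻¹ := by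
  have sub_isBigO : ∀ e : ℝ, ∀ᶠ z : ℂ in cobounded ℂ, ‖z‖ / 2 ≤ ‖z - e‖ := fun e => by
    filter_upwards [tendsto_norm_cobounded_atTop.eventually_ge_atTop (2 * ‖(e : ℂ)‖)] with z hz
    linarith [norm_sub_norm_le z e]
  refine IsBigO.of_bound 2 ?_
  filter_upwards [sub_isBigO (β + 2 * α), sub_isBigO (β - 2 * α),
    tendsto_norm_cobounded_atTop.eventually_gt_atTop 0] with z h₁ h₂ hz
  have : ‖z‖ / 2 ≤ ‖cutRoot α β z‖ :=
    calc ‖z‖ / 2 = √(‖z‖ / 2) * √(‖z‖ / 2) := (Real.mul_self_sqrt (by positivity)).symm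
      _ ≤ ‖cutRoot α β z‖ := by rw [norm_cutRoot]; gcongr
  calc ‖(cutRoot α β z)⁻¹‖ = ‖cutRoot α β z‖⁻¹ := norm_inv _
    _ ≤ (‖z‖ / 2)⁻¹ := by gcongr
    _ = 2 * ‖z⁻¹‖ := by rw [norm_inv, inv_div, div_eq_mul_inv]

lemma cutRoot_ofReal (α β x : ℝ) : cutRoot α β x =
    Complex.sqrt (x - β - 2 * α : ℝ) * Complex.sqrt (x - β + 2 * α : ℝ) := by
  rw [cutRoot]
  push_cast
  rfl

lemma exists_cutRoot_eq_I_mul (hx : x ∈ Set.Ioo (β - 2 * α) (β + 2 * α)) :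
    ∃ s : ℝ, 0 < s ∧ cutRoot α β x = Complex.I * s := by
  refine ⟨√(-(x - β - 2 * α)) * √(x - β + 2 * α),
    mul_pos (Real.sqrt_pos.2 (by linarith [hx.2])) (Real.sqrt_pos.2 (by linarith [hx.1])), ?_⟩
  rw [cutRoot_ofReal, sqrt_ofReal_of_nonpos (by linarith [hx.2]),
    sqrt_ofReal_of_nonneg (by linarith [hx.1])]
  push_cast
  ring

lemma cutRoot_of_gt (hα : 0 < α) (hx : β + 2 * α < x) :
    cutRoot α β x = (√(x - β - 2 * α) * √(x - β + 2 * α) : ℝ) := by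
  rw [cutRoot_ofReal, sqrt_ofReal_of_nonneg (by linarith), sqrt_ofReal_of_nonneg (by linarith),
    Complex.ofReal_mul]

lemma cutRoot_of_lt (hα : 0 < α) (hx : x < β - 2 * α) :
    cutRoot α β x = (-(√(-(x - β - 2 * α)) * √(-(x - β + 2 * α))) : ℝ) := by
  rw [cutRoot_ofReal, sqrt_ofReal_of_nonpos (by linarith), sqrt_ofReal_of_nonpos (by linarith),
    mul_mul_mul_comm, Complex.I_mul_I, Complex.ofReal_neg, Complex.ofReal_mul, neg_one_mul]

lemma exists_cutRoot_eq_ofReal (hα : 0 < α) (hx : x ∉ Set.Icc (β - 2 * α) (β + 2 * α)) :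
    ∃ s : ℝ, s ≠ 0 ∧ cutRoot α β x = s := by
  rw [Set.mem_Icc, not_and_or, not_le, not_le] at hx
  rcases hx with hx | hx
  · refine ⟨_, ?_, cutRoot_of_lt hα hx⟩
    exact neg_ne_zero.2
      (mul_pos (Real.sqrt_pos.2 (by linarith)) (Real.sqrt_pos.2 (by linarith))).ne'
  · refine ⟨_, ?_, cutRoot_of_gt hα hx⟩
    exact (mul_pos (Real.sqrt_pos.2 (by linarith)) (Real.sqrt_pos.2 (by linarith))).ne'

end CutRoot

section RootIntegral

open MeasureTheory Asymptotics Bornology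

lemma integrable_inv_one_add_abs_mul_sqrt_abs :
    Integrable fun x : ℝ => ((1 + |x|) * √|x|)⁻¹ := by
  have pos : IntegrableOn (fun x : ℝ => ((1 + |x|) * √|x|)⁻¹) (Set.Ioi 0) := by
    refine ((integrableOn_Ioi_comp_rpow_iff' (fun u : ℝ => (1 + u ^ 2)⁻¹)
      (one_half_pos (α := ℝ)).ne').2 integrable_inv_one_add_sq.integrableOn).congr_fun
      (fun x (hx : 0 < x) => ?_) measurableSet_Ioi
    have hexp : (1 / 2 - 1 : ℝ) = -(1 / 2) := by norm_num
    simp only [smul_eq_mul, hexp, Real.rpow_neg hx.le, ← Real.sqrt_eq_rpow, Real.sq_sqrt hx.le,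
      abs_of_pos hx, mul_inv]
    ring
  have neg : IntegrableOn (fun x : ℝ => ((1 + |x|) * √|x|)⁻¹) (Set.Iic 0) := by
    rw [integrableOn_Iic_iff_integrableOn_Iio]
    refine (IntegrableOn.comp_neg_Iio (by rwa [neg_zero])).congr_fun (fun x _ => ?_)
      measurableSet_Iio
    simp only [abs_neg]
  simpa [IntegrableOn] using neg.union pos

lemma integrable_inv_one_add_abs_mul_sqrt_abs_sub (e : ℝ) :
    Integrable fun x : ℝ => ((1 + |x|) * √|x - e|)⁻¹ := by
  refine ((integrable_inv_one_add_abs_mul_sqrt_abs.comp_sub_right e).const_mul (1 + |e|)).mono'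
    (by fun_prop) (ae_of_all _ fun x => ?_)
  have triangle : 1 + |x - e| ≤ (1 + |e|) * (1 + |x|) := by
    nlinarith [abs_sub x e, mul_nonneg (abs_nonneg e) (abs_nonneg x)]
  rw [Real.norm_of_nonneg (by positivity), mul_inv, mul_inv, ← mul_assoc]
  gcongr
  rw [inv_le_iff_one_le_mul₀ (by positivity), mul_right_comm, ← div_eq_mul_inv,
    one_le_div (by positivity)]
  exact triangle

lemma inv_sqrt_mul_sqrt_le {s A B : ℝ} (hs : 0 < s) (h : 2 * s ≤ A + B) :
    (√A * √B)⁻¹ ≤ (√s)⁻¹ * ((√A)⁻¹ + (√B)⁻¹) := by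
  have of_le : ∀ {A B : ℝ}, s ≤ A → (√A * √B)⁻¹ ≤ (√s)⁻¹ * ((√A)⁻¹ + (√B)⁻¹) := fun hA => by
    rw [mul_inv]
    gcongr
    exact le_add_of_nonneg_left (by positivity)
  rcases le_total s A with hA | hA
  · exact of_le hA
  · rw [mul_comm √A, add_comm (√A)⁻¹]
    exact of_le (by linarith)

lemma integrable_inv_one_add_abs_mul_norm_cutRoot {α : ℝ} (hα : 0 < α) (β : ℝ) :
    Integrable fun x : ℝ => ((1 + |x|) * (√|x - (β + 2 * α)| * √|x - (β - 2 * α)|))⁻¹ := by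
  refine (((integrable_inv_one_add_abs_mul_sqrt_abs_sub (β + 2 * α)).add
    (integrable_inv_one_add_abs_mul_sqrt_abs_sub (β - 2 * α))).const_mul (√(2 * α))⁻¹).mono'
    (by fun_prop) (ae_of_all _ fun x => ?_)
  have hdist : 2 * (2 * α) ≤ |x - (β + 2 * α)| + |x - (β - 2 * α)| := by
    have := abs_sub (x - (β - 2 * α)) (x - (β + 2 * α))
    rw [show x - (β - 2 * α) - (x - (β + 2 * α)) = 4 * α by ring] at this
    linarith [le_abs_self (4 * α)]
  rw [Real.norm_of_nonneg (by positivity), Pi.add_apply]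
  calc ((1 + |x|) * (√|x - (β + 2 * α)| * √|x - (β - 2 * α)|))⁻¹
      = (1 + |x|)⁻¹ * (√|x - (β + 2 * α)| * √|x - (β - 2 * α)|)⁻¹ := mul_inv _ _
    _ ≤ (1 + |x|)⁻¹ * ((√(2 * α))⁻¹ * ((√|x - (β + 2 * α)|)⁻¹ + (√|x - (β - 2 * α)|)⁻¹)) := by
      gcongr
      exact inv_sqrt_mul_sqrt_le (by positivity) hdist
    _ = (√(2 * α))⁻¹ * (((1 + |x|) * √|x - (β + 2 * α)|)⁻¹ +
        ((1 + |x|) * √|x - (β - 2 * α)|)⁻¹) := by simp only [mul_inv]; ring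

variable {φ : ℂ → ℂ} {φ₀ : ℝ → ℂ}

lemma HasBoundaryValues.mul {γ : ℂ → ℂ} {γ₀ : ℝ → ℂ} (hφ : HasBoundaryValues φ φ₀)
    (hγ : HasBoundaryValues γ γ₀) : HasBoundaryValues (φ * γ) (φ₀ * γ₀) where
  differentiableOn := hφ.differentiableOn.mul hγ.differentiableOn
  tendsto x := (hφ.tendsto x).mul (hγ.tendsto x)

lemma HasBoundaryValues.exists_norm_mul_one_add_norm_le (hφ : HasBoundaryValues φ φ₀)
    (hdecay : φ =O[cobounded ℂ ⊓ 𝓟 ℍₒ] fun z => z⁻¹) :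
    ∃ M, ∀ z ∈ ℍₒ, ‖φ z‖ * (1 + ‖z‖) ≤ M := by
  obtain ⟨C, hC⟩ := hdecay.bound
  rw [eventually_inf_principal] at hC
  obtain ⟨r, hr⟩ := (hasBasis_cobounded_norm.eventually_iff).1 hC
  obtain ⟨M, hM⟩ := hφ.exists_bound_of_norm_le (max r 1)
  refine ⟨max (M * (1 + max r 1)) (2 * C), fun z hz => ?_⟩
  rcases le_total ‖z‖ (max r 1) with hzr | hzr
  · refine le_max_of_le_left ?_
    have hM0 : 0 ≤ M := (norm_nonneg _).trans (hM z hz hzr)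
    have := hM z hz hzr
    gcongr
  · refine le_max_of_le_right ?_
    have hz1 : 1 ≤ ‖z‖ := (le_max_right _ _).trans hzr
    have hφz : ‖φ z‖ * ‖z‖ ≤ C := by
      have := hr.2 ((le_max_left _ _).trans hzr) hz
      rwa [norm_inv, ← div_eq_mul_inv, le_div_iff₀ (by linarith)] at this
    nlinarith [norm_nonneg (φ z)]

theorem integral_div_cutRoot_eq_zero {α : ℝ} (hα : 0 < α) (β : ℝ) (hφ : HasBoundaryValues φ φ₀)
    (hdecay : φ =O[cobounded ℂ ⊓ 𝓟 ℍₒ] fun z => z⁻¹) :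
    (Integrable fun x : ℝ => φ₀ x / cutRoot α β x) ∧ ∫ x : ℝ, φ₀ x / cutRoot α β x = 0 := by
  obtain ⟨M, hM⟩ := hφ.exists_norm_mul_one_add_norm_le hdecay
  have regular : ∀ᵐ x : ℝ, x ≠ β + 2 * α ∧ x ≠ β - 2 * α :=
    (Measure.ae_ne volume _).and (Measure.ae_ne volume _)
  refine integral_boundary_eq_zero (G := fun z => φ z / cutRoot α β z)
    (hφ.differentiableOn.div (differentiableOn_cutRoot α β)
      fun z hz => cutRoot_ne_zero_of_mem_upperHalfPlaneSet hz) ?_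
    ((integrable_inv_one_add_abs_mul_norm_cutRoot hα β).const_mul M) ?_ ?_
  · simpa only [div_eq_mul_inv, sq, mul_inv] using
      hdecay.mul ((inv_cutRoot_isBigO α β).mono inf_le_left)
  · filter_upwards [regular] with x hx y hy
    set z : ℂ := x + y * Complex.I with hz
    have hzU : z ∈ ℍₒ := by simpa [hz] using hy
    have abs_sub_le : ∀ e : ℝ, |x - e| ≤ ‖z - e‖ := fun e => by
      simpa [hz] using Complex.abs_re_le_norm (z - e)
    have abs_le : |x| ≤ ‖z‖ := by simpa using abs_sub_le 0
    have h₁ : 0 < √|x - (β + 2 * α)| := Real.sqrt_pos.2 (abs_pos.2 (sub_ne_zero.2 hx.1))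
    have h₂ : 0 < √|x - (β - 2 * α)| := Real.sqrt_pos.2 (abs_pos.2 (sub_ne_zero.2 hx.2))
    have hM0 : 0 ≤ M := le_trans (by positivity) (hM z hzU)
    calc ‖φ z / cutRoot α β z‖ = ‖φ z‖ / ‖cutRoot α β z‖ := norm_div _ _
      _ ≤ M / (1 + ‖z‖) / ‖cutRoot α β z‖ := by
        gcongr
        exact (le_div_iff₀ (by positivity)).2 (hM z hzU)
      _ = M * ((1 + ‖z‖) * ‖cutRoot α β z‖)⁻¹ := by rw [div_div, div_eq_mul_inv]
      _ ≤ M * ((1 + |x|) * (√|x - (β + 2 * α)| * √|x - (β - 2 * α)|))⁻¹ := by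
        rw [norm_cutRoot]
        gcongr
        exacts [abs_sub_le _, abs_sub_le _]
  · filter_upwards [regular] with x hx
    exact (hφ.tendsto x).div (tendsto_cutRoot α β x)
      (cutRoot_ne_zero (by exact_mod_cast hx.1) (by exact_mod_cast hx.2))

end RootIntegral

/-! ### The vanishing argument -/

section Vanishing

open MeasureTheory Asymptotics Bornology

/-- The scalar form of the jump condition for the components `f`, `g` of a row vector on the upper
sheet: `fu`, `gu` are their limits from above and `fd`, `gd` their limits from below the real
axis. The band of the root is `[β - 2α, β + 2α]`, the band of the other background is `[p, q]`. -/
structure JumpRelations (α β p q : ℝ) (fu gu fd gd : ℝ → ℂ) : Prop where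
  off : ∀ x, x ∉ Set.Icc (β - 2 * α) (β + 2 * α) → x ∉ Set.Icc p q → fu x = fd x ∧ gu x = gd x
  own : ∀ x ∈ Set.Ioo (β - 2 * α) (β + 2 * α), ∃ ρ : ℂ,
    fu x = ρ * fd x ∧ gu x = fd x - conj ρ * gd x
  cross : ∀ x ∈ Set.Ioo p q, ∃ κ : ℝ, 0 < κ ∧
    fu x = fd x - Complex.I * κ * cutRoot α β x * gd x ∧ gu x = gd x

/-- The combination of boundary values whose integral vanishes by Cauchy's theorem and which the
jump relations make nonnegative. -/
def jumpDensity (α β : ℝ) (fu gu fd gd : ℝ → ℂ) (x : ℝ) : ℂ :=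
  Complex.I * (fu x * conj (gd x) / cutRoot α β x - conj (conj (fd x) * gu x / cutRoot α β x))

lemma ae_eq_zero_of_integral_eq_zero {X : Type*} [MeasurableSpace X] {μ : Measure X} {D : X → ℂ}
    (hD : Integrable D μ) (h0 : ∫ x, D x ∂μ = 0) (hpos : ∀ᵐ x ∂μ, ∃ r : ℝ, 0 ≤ r ∧ D x = r) :
    D =ᵐ[μ] 0 := by
  have hre : ∫ x, (D x).re ∂μ = 0 := by simpa [h0] using integral_re hD
  have hnonneg : ∀ᵐ x ∂μ, 0 ≤ (D x).re := by
    filter_upwards [hpos] with x ⟨r, hr, hx⟩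
    simpa [hx] using hr
  filter_upwards [hpos, (integral_eq_zero_iff_of_nonneg_ae hnonneg hD.re).1 hre]
    with x ⟨r, _, hx⟩ hx0
  have hr : r = 0 := by simpa [hx] using hx0
  simp [hx, hr]

namespace JumpRelations

variable {α β p q : ℝ} {fu gu fd gd : ℝ → ℂ}

lemma jumpDensity_of_off (h : JumpRelations α β p q fu gu fd gd) (hα : 0 < α) {x : ℝ}
    (hx : x ∉ Set.Icc (β - 2 * α) (β + 2 * α)) (hx' : x ∉ Set.Icc p q) :
    jumpDensity α β fu gu fd gd x = 0 := by
  obtain ⟨hf, hg⟩ := h.off x hx hx'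
  obtain ⟨s, -, hR⟩ := exists_cutRoot_eq_ofReal hα hx
  simp only [jumpDensity, hR, hf, hg, map_div₀, map_mul, Complex.conj_conj, Complex.conj_ofReal]
  ring

lemma jumpDensity_of_own (h : JumpRelations α β p q fu gu fd gd) {x : ℝ}
    (hx : x ∈ Set.Ioo (β - 2 * α) (β + 2 * α)) :
    ∃ s : ℝ, 0 < s ∧ jumpDensity α β fu gu fd gd x = (s * ‖fd x‖ ^ 2 : ℝ) := by
  obtain ⟨ρ, hf, hg⟩ := h.own x hx
  obtain ⟨s, hs, hR⟩ := exists_cutRoot_eq_I_mul hx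
  refine ⟨s⁻¹, inv_pos.2 hs, ?_⟩
  have hs' : (s : ℂ) ≠ 0 := by exact_mod_cast hs.ne'
  simp only [jumpDensity, hR, hf, hg, map_div₀, map_mul, map_sub, Complex.conj_conj,
    Complex.conj_I, Complex.conj_ofReal]
  push_cast
  rw [← Complex.mul_conj']
  field_simp
  ring

lemma jumpDensity_of_cross (h : JumpRelations α β p q fu gu fd gd) (hα : 0 < α) {x : ℝ}
    (hx : x ∈ Set.Ioo p q) (hx' : x ∉ Set.Icc (β - 2 * α) (β + 2 * α)) :
    ∃ κ : ℝ, 0 < κ ∧ jumpDensity α β fu gu fd gd x = (κ * ‖gd x‖ ^ 2 : ℝ) := by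
  obtain ⟨κ, hκ, hf, hg⟩ := h.cross x hx
  obtain ⟨s, hs, hR⟩ := exists_cutRoot_eq_ofReal hα hx'
  refine ⟨κ, hκ, ?_⟩
  have hs' : (s : ℂ) ≠ 0 := by exact_mod_cast hs
  simp only [jumpDensity, hR, hf, hg, map_div₀, map_mul, Complex.conj_conj, Complex.conj_ofReal]
  push_cast
  rw [← Complex.mul_conj']
  field_simp
  linear_combination (-κ * s * gd x * conj (gd x)) * Complex.I_sq

lemma ae_exists_jumpDensity_eq (h : JumpRelations α β p q fu gu fd gd) (hα : 0 < α) :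
    ∀ᵐ x : ℝ, ∃ r : ℝ, 0 ≤ r ∧ jumpDensity α β fu gu fd gd x = r := by
  filter_upwards [Measure.ae_ne volume (β - 2 * α), Measure.ae_ne volume (β + 2 * α),
    Measure.ae_ne volume p, Measure.ae_ne volume q] with x hx₁ hx₂ hx₃ hx₄
  by_cases hb : x ∈ Set.Icc (β - 2 * α) (β + 2 * α)
  · obtain ⟨s, hs, hD⟩ := h.jumpDensity_of_own ⟨hb.1.lt_of_ne' hx₁, hb.2.lt_of_ne hx₂⟩
    exact ⟨_, by positivity, hD⟩
  by_cases hc : x ∈ Set.Icc p q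
  · obtain ⟨κ, hκ, hD⟩ := h.jumpDensity_of_cross hα ⟨hc.1.lt_of_ne' hx₃, hc.2.lt_of_ne hx₄⟩ hb
    exact ⟨_, by positivity, hD⟩
  · exact ⟨0, le_rfl, by simpa using h.jumpDensity_of_off hα hb hc⟩

lemma eqOn_zero_of_jumpDensity_ae_eq_zero {f : ℂ → ℂ} {f₀ : ℝ → ℂ}
    (hf : HasBoundaryValues f fun x => conj (f₀ x)) {s : Set ℝ} (hs : IsOpen s)
    (hD : jumpDensity α β fu gu fd gd =ᵐ[volume] 0)
    (hpos : ∀ x ∈ s, ∃ κ : ℝ, 0 < κ ∧ jumpDensity α β fu gu fd gd x = (κ * ‖f₀ x‖ ^ 2 : ℝ)) :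
    Set.EqOn f₀ 0 s := by
  have ae_zero : (fun x => conj (f₀ x)) =ᵐ[volume.restrict s] 0 := by
    rw [EventuallyEq, ae_restrict_iff' hs.measurableSet]
    filter_upwards [hD] with x hx hxs
    obtain ⟨κ, hκ, h⟩ := hpos x hxs
    rw [h, Pi.zero_apply, Complex.ofReal_eq_zero, mul_eq_zero, or_iff_right hκ.ne'] at hx
    simpa using hx
  intro x hx
  simpa using Measure.eqOn_open_of_ae_eq ae_zero hs hf.continuous.continuousOn
    continuousOn_const hx

variable {f g f' g' : ℂ → ℂ}

lemma jumpDensity_ae_eq_zero (h : JumpRelations α β p q fu gu fd gd) (hα : 0 < α)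
    (hf : HasBoundaryValues f fu) (hg : HasBoundaryValues g gu)
    (hf' : HasBoundaryValues f' fun x => conj (fd x))
    (hg' : HasBoundaryValues g' fun x => conj (gd x))
    (hf_infty : f =O[cobounded ℂ ⊓ 𝓟 ℍₒ] fun z => z⁻¹)
    (hg_infty : g =O[cobounded ℂ ⊓ 𝓟 ℍₒ] fun _ => (1 : ℂ))
    (hf'_infty : f' =O[cobounded ℂ ⊓ 𝓟 ℍₒ] fun z => z⁻¹)
    (hg'_infty : g' =O[cobounded ℂ ⊓ 𝓟 ℍₒ] fun _ => (1 : ℂ)) :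
    jumpDensity α β fu gu fd gd =ᵐ[volume] 0 := by
  obtain ⟨hint, hzero⟩ := integral_div_cutRoot_eq_zero hα β (hf.mul hg')
    ((hf_infty.mul hg'_infty).congr_right fun _ => mul_one _)
  obtain ⟨hint', hzero'⟩ := integral_div_cutRoot_eq_zero hα β (hf'.mul hg)
    ((hf'_infty.mul hg_infty).congr_right fun _ => mul_one _)
  simp only [Pi.mul_apply] at hint hzero hint' hzero'
  have hint_conj : Integrable fun x : ℝ => conj (conj (fd x) * gu x / cutRoot α β x) :=
    (LinearIsometryEquiv.integrable_comp_iff Complex.conjLIE).2 hint'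
  refine ae_eq_zero_of_integral_eq_zero ((hint.sub hint_conj).const_mul _) ?_
    (h.ae_exists_jumpDensity_eq hα)
  simp only [jumpDensity]
  rw [integral_const_mul, integral_sub hint hint_conj, hzero, integral_conj, hzero']
  simp only [map_zero, sub_zero, mul_zero]

theorem eqOn_zero (h : JumpRelations α β p q fu gu fd gd) (hα : 0 < α) (hpq : p < q)
    (hdisj : Disjoint (Set.Icc p q) (Set.Icc (β - 2 * α) (β + 2 * α)))
    (hf : HasBoundaryValues f fu) (hg : HasBoundaryValues g gu)
    (hf' : HasBoundaryValues f' fun x => conj (fd x))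
    (hg' : HasBoundaryValues g' fun x => conj (gd x))
    (hf_infty : f =O[cobounded ℂ ⊓ 𝓟 ℍₒ] fun z => z⁻¹)
    (hg_infty : g =O[cobounded ℂ ⊓ 𝓟 ℍₒ] fun _ => (1 : ℂ))
    (hf'_infty : f' =O[cobounded ℂ ⊓ 𝓟 ℍₒ] fun z => z⁻¹)
    (hg'_infty : g' =O[cobounded ℂ ⊓ 𝓟 ℍₒ] fun _ => (1 : ℂ)) :
    Set.EqOn f 0 ℍₒ ∧ Set.EqOn g 0 ℍₒ ∧ Set.EqOn f' 0 ℍₒ ∧ Set.EqOn g' 0 ℍₒ := by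
  have hD : jumpDensity α β fu gu fd gd =ᵐ[volume] 0 :=
    h.jumpDensity_ae_eq_zero hα hf hg hf' hg' hf_infty hg_infty hf'_infty hg'_infty
  have hfd : Set.EqOn fd 0 (Set.Ioo (β - 2 * α) (β + 2 * α)) :=
    eqOn_zero_of_jumpDensity_ae_eq_zero hf' isOpen_Ioo hD fun _ hx => h.jumpDensity_of_own hx
  have hgd : Set.EqOn gd 0 (Set.Ioo p q) :=
    eqOn_zero_of_jumpDensity_ae_eq_zero hg' isOpen_Ioo hD fun _ hx =>
      h.jumpDensity_of_cross hα hx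
        (Set.disjoint_left.1 hdisj (Set.Ioo_subset_Icc_self hx))
  have hlt : β - 2 * α < β + 2 * α := by linarith
  refine ⟨hf.eqOn_zero_of_boundary_eq_zero hlt fun x hx => ?_,
    hg.eqOn_zero_of_boundary_eq_zero hpq fun x hx => ?_,
    hf'.eqOn_zero_of_boundary_eq_zero hlt fun x hx => by simp [hfd hx],
    hg'.eqOn_zero_of_boundary_eq_zero hpq fun x hx => by simp [hgd hx]⟩
  · obtain ⟨ρ, hfu, -⟩ := h.own x hx
    simp [hfu, hfd hx]
  · obtain ⟨κ, -, -, hgu⟩ := h.cross x hx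
    simp [hgu, hgd hx]

end JumpRelations

end Vanishing

/-! ### Solutions of the Riemann-Hilbert problem off the contour -/

section PreSolution

open Asymptotics Bornology

variable {c d : ℝ} {v : ℝ → Side → Matrix (Fin 2) (Fin 2) ℂ} {m m' : SurfPt → Fin 2 → ℂ}

lemma isClosed_cuts (c d : ℝ) : IsClosed (cuts c d) :=
  ((isCompact_Icc.union isCompact_Icc).image Complex.continuous_ofReal).isClosed

lemma notMem_cuts_of_im_ne_zero {z : ℂ} (hz : z.im ≠ 0) : z ∉ cuts c d := by
  rintro ⟨x, -, rfl⟩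
  exact hz (Complex.ofReal_im x)

lemma ofReal_mem_cuts {x : ℝ} : (x : ℂ) ∈ cuts c d ↔ x ∈ bandOne c d ∪ bandTwo :=
  Complex.ofReal_injective.mem_set_image

lemma coe_mem_offContour {s : Sheet} {z : ℂ} :
    ((s, (z : OnePoint ℂ)) : SurfPt) ∈ offContour c d ↔ z ∉ cuts c d :=
  OnePoint.coe_injective.mem_set_image.not

lemma infty_mem_offContour {s : Sheet} : ((s, OnePoint.infty) : SurfPt) ∈ offContour c d := by
  rintro ⟨z, -, h⟩
  exact OnePoint.coe_ne_infty z h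

lemma inftyChart_zero : inftyChart 0 = OnePoint.infty := if_pos rfl

lemma inftyChart_inv {z : ℂ} (hz : z ≠ 0) : inftyChart z⁻¹ = (z : OnePoint ℂ) := by
  rw [inftyChart, if_neg (inv_ne_zero hz), inv_inv]

lemma nhdsWithin_le_approach_up (c d x : ℝ) : 𝓝[ℍₒ] (x : ℂ) ≤ approach c d x .up := by
  rw [approach]
  split_ifs
  · exact nhdsWithin_mono _ fun z hz => notMem_cuts_of_im_ne_zero (ne_of_gt hz)
  · exact le_rfl

lemma nhdsWithin_le_approach_down (c d x : ℝ) :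
    𝓝[{z : ℂ | z.im < 0}] (x : ℂ) ≤ approach c d x .down := by
  rw [approach]
  split_ifs
  · exact nhdsWithin_mono _ fun z hz => notMem_cuts_of_im_ne_zero (ne_of_lt hz)
  · exact le_rfl

lemma vecMul_swap (u : Fin 2 → ℂ) : u ᵥ* !![0, 1; 1, 0] = ![u 1, u 0] := by
  ext i
  fin_cases i <;> simp [vecMul, dotProduct]

lemma isBigO_conj_comp_conj {φ γ : ℂ → ℂ} (h : φ =O[cobounded ℂ] γ)
    (hγ : ∀ z, ‖γ (conj z)‖ = ‖γ z‖) : (fun z => conj (φ (conj z))) =O[cobounded ℂ] γ := by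
  have hconj : Tendsto (fun z : ℂ => conj z) (cobounded ℂ) (cobounded ℂ) :=
    Complex.conjLIE.antilipschitz.tendsto_cobounded
  refine IsBigO.of_norm_norm ?_
  simpa only [Function.comp_def, Complex.norm_conj, hγ] using (h.comp_tendsto hconj).norm_norm

/-- The restriction of `m` to the finite points of the upper sheet, as a function of `λ`. -/
def onUpperSheet (m : SurfPt → Fin 2 → ℂ) (z : ℂ) : Fin 2 → ℂ := m (.upper, (z : OnePoint ℂ))

namespace IsPreSolution

lemma lower_eq (h : IsPreSolution c d v m) {z : OnePoint ℂ}
    (hz : ((Sheet.upper, z) : SurfPt) ∈ offContour c d) :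
    m (.lower, z) = ![m (.upper, z) 1, m (.upper, z) 0] :=
  (h.symmetry _ hz).trans (vecMul_swap _)

lemma differentiableAt_onUpperSheet (h : IsPreSolution c d v m) {z : ℂ} (hz : z ∉ cuts c d) :
    DifferentiableAt ℂ (onUpperSheet m) z :=
  (h.holomorphic .upper).1.differentiableAt ((isClosed_cuts c d).isOpen_compl.mem_nhds hz)

lemma exists_tendsto_of_mem (h : IsPreSolution c d v m) {x : ℝ}
    (hx : x ∈ bandOne c d ∪ bandTwo) : ∃ u w : Fin 2 → ℂ,
      Tendsto (onUpperSheet m) (𝓝[ℍₒ] (x : ℂ)) (𝓝 u) ∧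
      Tendsto (onUpperSheet m) (𝓝[{z : ℂ | z.im < 0}] (x : ℂ)) (𝓝 w) ∧
      u = ![w 1, w 0] ᵥ* v x .up := by
  obtain ⟨mPlus, mMinus, hPlus, hMinus, hjump⟩ := h.jump x hx .up
  have swap_swap : ∀ w : Fin 2 → ℂ, ![w 1, w 0] ᵥ* !![0, 1; 1, 0] = w := fun w => by
    rw [vecMul_swap]
    ext i
    fin_cases i <;> rfl
  refine ⟨mPlus, mMinus ᵥ* !![0, 1; 1, 0],
    hPlus.mono_left (nhdsWithin_le_approach_up c d x), ?_, ?_⟩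
  · have hcont : Continuous fun w : Fin 2 → ℂ => w ᵥ* !![0, 1; 1, 0] := by fun_prop
    refine ((hcont.tendsto _).comp (hMinus.mono_left (nhdsWithin_le_approach_down c d x))).congr' ?_
    filter_upwards [self_mem_nhdsWithin] with z hz
    rw [Function.comp_apply,
      h.lower_eq (coe_mem_offContour.2 (notMem_cuts_of_im_ne_zero (ne_of_lt hz))), swap_swap]
    rfl
  · rwa [← vecMul_swap, vecMul_swap mMinus, swap_swap]

lemma exists_boundary (h : IsPreSolution c d v m) : ∃ mu md : ℝ → Fin 2 → ℂ,
    (∀ x : ℝ, Tendsto (onUpperSheet m) (𝓝[ℍₒ] (x : ℂ)) (𝓝 (mu x))) ∧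
    (∀ x : ℝ, Tendsto (onUpperSheet m) (𝓝[{z : ℂ | z.im < 0}] (x : ℂ)) (𝓝 (md x))) ∧
    (∀ x ∉ bandOne c d ∪ bandTwo, mu x = md x) ∧
    ∀ x ∈ bandOne c d ∪ bandTwo, mu x = ![md x 1, md x 0] ᵥ* v x .up := by
  have pointwise : ∀ x : ℝ, ∃ u w : Fin 2 → ℂ,
      Tendsto (onUpperSheet m) (𝓝[ℍₒ] (x : ℂ)) (𝓝 u) ∧
      Tendsto (onUpperSheet m) (𝓝[{z : ℂ | z.im < 0}] (x : ℂ)) (𝓝 w) ∧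
      (x ∉ bandOne c d ∪ bandTwo → u = w) ∧
      (x ∈ bandOne c d ∪ bandTwo → u = ![w 1, w 0] ᵥ* v x .up) := fun x => by
    by_cases hx : x ∈ bandOne c d ∪ bandTwo
    · obtain ⟨u, w, hu, hw, huw⟩ := h.exists_tendsto_of_mem hx
      exact ⟨u, w, hu, hw, fun hx' => absurd hx hx', fun _ => huw⟩
    · have hcont := (h.differentiableAt_onUpperSheet (ofReal_mem_cuts.not.2 hx)).continuousAt
      exact ⟨_, _, hcont.mono_left nhdsWithin_le_nhds, hcont.mono_left nhdsWithin_le_nhds,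
        fun _ => rfl, fun hx' => absurd hx' hx⟩
  choose mu md hmu hmd hoff hon using pointwise
  exact ⟨mu, md, hmu, hmd, hoff, hon⟩

lemma sub_infty_isBigO (h : IsPreSolution c d v m) :
    (fun z => onUpperSheet m z - m (.upper, OnePoint.infty)) =O[cobounded ℂ] fun z => z⁻¹ := by
  refine ((h.holomorphic .upper).2.isBigO_sub.comp_tendsto tendsto_inv₀_cobounded).congr' ?_
    (Eventually.of_forall fun z => sub_zero z⁻¹)
  filter_upwards [eventually_ne_cobounded (0 : ℂ)] with z hz
  rw [Function.comp_apply, inftyChart_inv hz, inftyChart_zero]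
  rfl

lemma tendsto_infty (h : IsPreSolution c d v m) :
    Tendsto (onUpperSheet m) (cocompact ℂ) (𝓝 (m (.upper, OnePoint.infty))) := by
  rw [← Metric.cobounded_eq_cocompact]
  exact tendsto_sub_nhds_zero_iff.1 (h.sub_infty_isBigO.trans_tendsto tendsto_inv₀_cobounded)

lemma isBigO_inv (h : IsPreSolution c d v m) {i : Fin 2}
    (h0 : m (.upper, OnePoint.infty) i = 0) :
    (fun z => onUpperSheet m z i) =O[cobounded ℂ] fun z => z⁻¹ := by
  simpa only [Pi.sub_apply, h0, sub_zero] using isBigO_pi.1 h.sub_infty_isBigO i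

lemma isBigO_one (h : IsPreSolution c d v m) (i : Fin 2) :
    (fun z => onUpperSheet m z i) =O[cobounded ℂ] fun _ => (1 : ℂ) := by
  rw [Metric.cobounded_eq_cocompact]
  exact (tendsto_pi_nhds.1 h.tendsto_infty i).isBigO_one ℂ

lemma hasBoundaryValues (h : IsPreSolution c d v m) {mu : ℝ → Fin 2 → ℂ}
    (hmu : ∀ x : ℝ, Tendsto (onUpperSheet m) (𝓝[ℍₒ] (x : ℂ)) (𝓝 (mu x))) (i : Fin 2) :
    HasBoundaryValues (fun z => onUpperSheet m z i) fun x => mu x i where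
  differentiableOn _ hz := (differentiableAt_pi.1 (h.differentiableAt_onUpperSheet
    (notMem_cuts_of_im_ne_zero (ne_of_gt hz))) i).differentiableWithinAt
  tendsto x := tendsto_pi_nhds.1 (hmu x) i

lemma hasBoundaryValues_conj (h : IsPreSolution c d v m) {md : ℝ → Fin 2 → ℂ}
    (hmd : ∀ x : ℝ, Tendsto (onUpperSheet m) (𝓝[{z : ℂ | z.im < 0}] (x : ℂ)) (𝓝 (md x)))
    (i : Fin 2) :
    HasBoundaryValues (fun z => conj (onUpperSheet m (conj z) i)) fun x => conj (md x i) where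
  differentiableOn z hz := by
    have hz' : conj z ∉ cuts c d :=
      notMem_cuts_of_im_ne_zero (by simpa using (show 0 < z.im from hz).ne')
    have := (differentiableAt_pi.1 (h.differentiableAt_onUpperSheet hz') i).conj_conj
    rw [Complex.conj_conj] at this
    exact this.differentiableWithinAt
  tendsto x := by
    have hconj : Tendsto (fun z : ℂ => conj z) (𝓝[ℍₒ] (x : ℂ)) (𝓝[{z : ℂ | z.im < 0}] (x : ℂ)) :=
      tendsto_nhdsWithin_iff.2
        ⟨(Complex.continuous_conj.tendsto' _ _ (Complex.conj_ofReal x)).mono_left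
          nhdsWithin_le_nhds, by
          filter_upwards [self_mem_nhdsWithin] with z (hz : 0 < z.im)
          simpa using hz⟩
    exact (Complex.continuous_conj.tendsto _).comp ((tendsto_pi_nhds.1 (hmd x) i).comp hconj)

lemma upper_eq_zero_of_im_ne_zero (h : IsPreSolution c d v m)
    (h0 : ∀ z : ℂ, z.im ≠ 0 → onUpperSheet m z = 0) {z : OnePoint ℂ}
    (hz : ((Sheet.upper, z) : SurfPt) ∈ offContour c d) : m (.upper, z) = 0 := by
  induction z using OnePoint.rec with
  | infty =>
    have hI : Tendsto (fun y : ℝ => (y : ℂ) * Complex.I) atTop (cocompact ℂ) := by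
      rw [← Metric.cobounded_eq_cocompact, ← tendsto_norm_atTop_iff_cobounded]
      simpa using tendsto_abs_atTop_atTop
    refine tendsto_nhds_unique (h.tendsto_infty.comp hI) (tendsto_const_nhds.congr' ?_)
    filter_upwards [eventually_gt_atTop 0] with y hy
    exact (h0 _ (by simpa using hy.ne')).symm
  | coe z =>
    by_cases him : z.im = 0
    · lift z to ℝ using him
      have hcont := (h.differentiableAt_onUpperSheet (coe_mem_offContour.1 hz)).continuousAt
      refine tendsto_nhds_unique (hcont.mono_left (nhdsWithin_le_nhds (s := ℍₒ)))
        (tendsto_const_nhds.congr' ?_)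
      filter_upwards [self_mem_nhdsWithin] with w hw
      exact (h0 w (ne_of_gt hw)).symm
    · exact h0 z him

lemma eqOn_zero_of_im_ne_zero (h : IsPreSolution c d v m)
    (h0 : ∀ z : ℂ, z.im ≠ 0 → onUpperSheet m z = 0) : Set.EqOn m 0 (offContour c d) := by
  rintro ⟨s, z⟩ hz
  cases s with
  | upper => exact h.upper_eq_zero_of_im_ne_zero h0 hz
  | lower =>
    have hz' : ((Sheet.upper, z) : SurfPt) ∈ offContour c d := hz
    ext i
    rw [h.lower_eq hz', h.upper_eq_zero_of_im_ne_zero h0 hz']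
    fin_cases i <;> rfl

lemma smul_sub_smul (h : IsPreSolution c d v m) (h' : IsPreSolution c d v m') (s s' : ℂ) :
    IsPreSolution c d v (s • m - s' • m') where
  holomorphic σ :=
    ⟨((h.holomorphic σ).1.const_smul s).sub ((h'.holomorphic σ).1.const_smul s'),
      ((h.holomorphic σ).2.const_smul s).sub ((h'.holomorphic σ).2.const_smul s')⟩
  jump x hx σ := by
    obtain ⟨p, q, hp, hq, hpq⟩ := h.jump x hx σ
    obtain ⟨p', q', hp', hq', hpq'⟩ := h'.jump x hx σ
    refine ⟨s • p - s' • p', s • q - s' • q', (hp.const_smul s).sub (hp'.const_smul s'),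
      (hq.const_smul s).sub (hq'.const_smul s'), ?_⟩
    rw [sub_vecMul, smul_vecMul, smul_vecMul, hpq, hpq']
  symmetry p hp := by
    simp only [Pi.sub_apply, Pi.smul_apply, h.symmetry p hp, h'.symmetry p hp, sub_vecMul,
      smul_vecMul]

end IsPreSolution

theorem IsSolution.eqOn_of_vanishing
    (hv : ∀ m, IsVanishingSolution c d v m → Set.EqOn m 0 (offContour c d))
    (h : IsSolution c d v m) (h' : IsSolution c d v m') : Set.EqOn m m' (offContour c d) := by
  obtain ⟨s, t, hl, hst, hs⟩ := h.normalization
  obtain ⟨s', t', hl', hst', hs'⟩ := h'.normalization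
  have hm := tendsto_nhds_unique h.toIsPreSolution.tendsto_infty hl
  have hm' := tendsto_nhds_unique h'.toIsPreSolution.tendsto_infty hl'
  have hzero : Set.EqOn ((s' : ℂ) • m - (s : ℂ) • m') 0 (offContour c d) :=
    hv _ ⟨h.toIsPreSolution.smul_sub_smul h'.toIsPreSolution s' s, by simp [hm, hm', mul_comm]⟩
  have hss : s = s' := by
    have h1 : s' * t - s * t' = 0 := by
      simpa [hm, hm'] using congrFun (hzero (infty_mem_offContour (s := .upper))) 1
    have h2 : (s : ℂ) ^ 2 = (s' : ℂ) ^ 2 := by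
      linear_combination s * s' * (-h1) + s' ^ 2 * hst - s ^ 2 * hst'
    exact (pow_left_inj₀ hs.le hs'.le two_ne_zero).1 (by exact_mod_cast h2)
  intro p hp
  have hp0 := hzero hp
  rw [hss, ← smul_sub, Pi.smul_apply, Pi.zero_apply, smul_eq_zero,
    or_iff_right (by exact_mod_cast hs'.ne')] at hp0
  exact sub_eq_zero.1 hp0

/-- The shape of the jump matrix along `x + i0` on which the uniqueness argument rests. The bands
`I₁`, `I₂` are, in either order, the band `[β - 2α, β + 2α]` of the background in question and the
band `[p, q]` of the other one. -/
structure HasJumpForm (c d α β p q : ℝ) (v : ℝ → Side → Matrix (Fin 2) (Fin 2) ℂ) : Prop where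
  pos : 0 < α
  lt : p < q
  disjoint : Disjoint (Set.Icc p q) (Set.Icc (β - 2 * α) (β + 2 * α))
  bands_eq : bandOne c d ∪ bandTwo = Set.Icc (β - 2 * α) (β + 2 * α) ∪ Set.Icc p q
  own : ∀ x ∈ Set.Ioo (β - 2 * α) (β + 2 * α), ∃ ρ : ℂ, v x .up = !![0, -conj ρ; ρ, 1]
  cross : ∀ x ∈ Set.Ioo p q, ∃ κ : ℝ, 0 < κ ∧
    v x .up = !![-(Complex.I * κ * cutRoot α β x), 1; 1, 0]

namespace HasJumpForm

variable {α β p q : ℝ}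

lemma jumpRelations (hv : HasJumpForm c d α β p q v) {mu md : ℝ → Fin 2 → ℂ}
    (hoff : ∀ x ∉ bandOne c d ∪ bandTwo, mu x = md x)
    (hon : ∀ x ∈ bandOne c d ∪ bandTwo, mu x = ![md x 1, md x 0] ᵥ* v x .up) :
    JumpRelations α β p q (mu · 0) (mu · 1) (md · 0) (md · 1) where
  off x hx hx' := by
    rw [hoff x (by rw [hv.bands_eq]; exact fun h => h.elim hx hx')]
    exact ⟨rfl, rfl⟩
  own x hx := by
    obtain ⟨ρ, hvx⟩ := hv.own x hx
    have hjump := hon x (by rw [hv.bands_eq]; exact Or.inl (Set.Ioo_subset_Icc_self hx))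
    rw [hvx] at hjump
    refine ⟨ρ, ?_, ?_⟩ <;> rw [hjump] <;> simp [vecMul, dotProduct] <;> ring
  cross x hx := by
    obtain ⟨κ, hκ, hvx⟩ := hv.cross x hx
    have hjump := hon x (by rw [hv.bands_eq]; exact Or.inr (Set.Ioo_subset_Icc_self hx))
    rw [hvx] at hjump
    refine ⟨κ, hκ, ?_, ?_⟩ <;> rw [hjump] <;> simp [vecMul, dotProduct]
    ring

theorem eqOn_zero_of_vanishing (hv : HasJumpForm c d α β p q v)
    (h : IsVanishingSolution c d v m) : Set.EqOn m 0 (offContour c d) := by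
  obtain ⟨h, h0⟩ := h
  obtain ⟨mu, md, hmu, hmd, hoff, hon⟩ := h.exists_boundary
  obtain ⟨hf, hg, hf', hg'⟩ := (hv.jumpRelations hoff hon).eqOn_zero hv.pos hv.lt hv.disjoint
    (h.hasBoundaryValues hmu 0) (h.hasBoundaryValues hmu 1)
    (h.hasBoundaryValues_conj hmd 0) (h.hasBoundaryValues_conj hmd 1)
    ((h.isBigO_inv h0).mono inf_le_left) ((h.isBigO_one 1).mono inf_le_left)
    ((isBigO_conj_comp_conj (h.isBigO_inv h0) fun z => by simp).mono inf_le_left)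
    ((isBigO_conj_comp_conj (h.isBigO_one 1) fun _ => rfl).mono inf_le_left)
  refine h.eqOn_zero_of_im_ne_zero fun z hz => ?_
  rcases lt_or_gt_of_ne hz with hz | hz
  · have hz' : conj z ∈ ℍₒ := by simpa using hz
    ext i
    fin_cases i
    exacts [by simpa using hf' hz', by simpa using hg' hz']
  · ext i
    fin_cases i
    exacts [hf hz, hg hz]

theorem eqOn_of_isSolution (hv : HasJumpForm c d α β p q v) (h : IsSolution c d v m)
    (h' : IsSolution c d v m') : Set.EqOn m m' (offContour c d) :=
  h.eqOn_of_vanishing (fun _ => hv.eqOn_zero_of_vanishing) h'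

end HasJumpForm

end PreSolution

/-! ### The Joukovski variable on the real line -/

section Joukovski

variable {α β x : ℝ}

lemma rootAt_sq (α β x : ℝ) (σ : Side) : rootAt α β x σ ^ 2 = ((x : ℂ) - β) ^ 2 - 4 * α ^ 2 := by
  cases σ
  · exact cutRoot_sq α β x
  · rw [rootAt, ← map_pow, cutRoot_sq]
    simp [Complex.conj_ofNat]

lemma rootAt_ne_zero (h₁ : x ≠ β - 2 * α) (h₂ : x ≠ β + 2 * α) (σ : Side) :
    rootAt α β x σ ≠ 0 := by
  refine ne_zero_pow two_ne_zero ?_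
  have hprod : (x - (β - 2 * α)) * (x - (β + 2 * α)) ≠ 0 :=
    mul_ne_zero (sub_ne_zero.2 h₁) (sub_ne_zero.2 h₂)
  rw [rootAt_sq]
  convert Complex.ofReal_ne_zero.2 hprod using 1
  push_cast
  ring

lemma zAt_mul (hα : α ≠ 0) (β x : ℝ) (σ : Side) :
    zAt α β x σ * (((x : ℂ) - β + rootAt α β x σ) / (2 * α)) = 1 := by
  have hα' : (α : ℂ) ≠ 0 := mod_cast hα
  rw [zAt]
  field_simp
  linear_combination -rootAt_sq α β x σ

lemma zAt_ne_zero (hα : α ≠ 0) (β x : ℝ) (σ : Side) : zAt α β x σ ≠ 0 :=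
  left_ne_zero_of_mul_eq_one (zAt_mul hα β x σ)

lemma zAt_inv (hα : α ≠ 0) (β x : ℝ) (σ : Side) :
    (zAt α β x σ)⁻¹ = ((x : ℂ) - β + rootAt α β x σ) / (2 * α) :=
  inv_eq_of_mul_eq_one_right (zAt_mul hα β x σ)

lemma add_mul_zAt_add_inv (hα : α ≠ 0) (β x : ℝ) (σ : Side) :
    β + α * (zAt α β x σ + (zAt α β x σ)⁻¹) = (x : ℂ) := by
  have hα' : (α : ℂ) ≠ 0 := mod_cast hα
  rw [zAt_inv hα, zAt]
  field_simp
  ring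

lemma mul_zAt_inv_sub (hα : α ≠ 0) (β x : ℝ) (σ : Side) :
    α * ((zAt α β x σ)⁻¹ - zAt α β x σ) = rootAt α β x σ := by
  have hα' : (α : ℂ) ≠ 0 := mod_cast hα
  rw [zAt_inv hα, zAt]
  field_simp
  ring

lemma zAt_sq_ne_one (hα : α ≠ 0) {σ : Side} (h : rootAt α β x σ ≠ 0) : zAt α β x σ ^ 2 ≠ 1 := by
  intro hz
  rw [← mul_zAt_inv_sub hα, inv_eq_of_mul_eq_one_right (by rwa [← pow_two]), sub_self,
    mul_zero] at h
  exact h rfl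

lemma norm_zAt_eq_one (hα : α ≠ 0) (hx : x ∈ Set.Ioo (β - 2 * α) (β + 2 * α)) (σ : Side) :
    ‖zAt α β x σ‖ = 1 := by
  obtain ⟨s, -, hs⟩ := exists_cutRoot_eq_I_mul hx
  have hconj : conj (zAt α β x σ) = (zAt α β x σ)⁻¹ := by
    rw [zAt_inv hα, zAt]
    cases σ <;> simp [rootAt, hs, sub_eq_add_neg, Complex.conj_ofNat]
  have hsq : (‖zAt α β x σ‖ : ℂ) ^ 2 = 1 := by
    rw [← Complex.mul_conj', hconj, mul_inv_cancel₀ (zAt_ne_zero hα β x σ)]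
  exact (pow_eq_one_iff_of_nonneg (norm_nonneg _) two_ne_zero).1 (mod_cast hsq)

lemma rootAt_eq_cutRoot_of_notMem (hα : 0 < α) (hx : x ∉ Set.Icc (β - 2 * α) (β + 2 * α))
    (σ : Side) : rootAt α β x σ = cutRoot α β x := by
  obtain ⟨s, -, hs⟩ := exists_cutRoot_eq_ofReal hα hx
  cases σ
  · rfl
  · rw [rootAt, hs, Complex.conj_ofReal]

lemma exists_zAt_eq_ofReal (hα : 0 < α) (hx : x ∉ Set.Icc (β - 2 * α) (β + 2 * α)) (σ : Side) :
    ∃ u : ℝ, zAt α β x σ = u := by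
  obtain ⟨s, -, hs⟩ := exists_cutRoot_eq_ofReal hα hx
  refine ⟨(x - β - s) / (2 * α), ?_⟩
  rw [zAt, rootAt_eq_cutRoot_of_notMem hα hx, hs]
  push_cast
  rfl

lemma two_mul_lt_norm_sub_add_cutRoot (hα : 0 < α)
    (hx : x ∉ Set.Icc (β - 2 * α) (β + 2 * α)) : 2 * α < ‖(x : ℂ) - β + cutRoot α β x‖ := by
  rw [Set.mem_Icc, not_and_or, not_le, not_le] at hx
  rcases hx with hx | hx
  · rw [cutRoot_of_lt hα hx, ← Complex.ofReal_sub, ← Complex.ofReal_add, Complex.norm_real,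
      Real.norm_eq_abs, lt_abs]
    right
    have : 0 ≤ √(-(x - β - 2 * α)) * √(-(x - β + 2 * α)) := by positivity
    linarith
  · rw [cutRoot_of_gt hα hx, ← Complex.ofReal_sub, ← Complex.ofReal_add, Complex.norm_real,
      Real.norm_eq_abs, lt_abs]
    left
    have : 0 ≤ √(x - β - 2 * α) * √(x - β + 2 * α) := by positivity
    linarith

lemma norm_zAt_lt_one (hα : 0 < α) (hx : x ∉ Set.Icc (β - 2 * α) (β + 2 * α)) (σ : Side) :
    ‖zAt α β x σ‖ < 1 := by
  have hinv : 1 < ‖(zAt α β x σ)⁻¹‖ := by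
    rw [zAt_inv hα.ne', rootAt_eq_cutRoot_of_notMem hα hx, norm_div,
      show ‖(2 * α : ℂ)‖ = 2 * α by simp [abs_of_pos hα], one_lt_div (by positivity)]
    exact two_mul_lt_norm_sub_add_cutRoot hα hx
  rw [norm_inv] at hinv
  exact (one_lt_inv₀ (norm_pos_iff.2 (zAt_ne_zero hα.ne' β x σ))).1 hinv

lemma norm_zAt_le_one (hα : 0 < α) (h₁ : x ≠ β - 2 * α) (h₂ : x ≠ β + 2 * α) (σ : Side) :
    ‖zAt α β x σ‖ ≤ 1 := by
  by_cases hx : x ∈ Set.Icc (β - 2 * α) (β + 2 * α)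
  · exact (norm_zAt_eq_one hα.ne' ⟨hx.1.lt_of_ne h₁.symm, hx.2.lt_of_ne h₂⟩ σ).le
  · exact (norm_zAt_lt_one hα hx σ).le

end Joukovski

/-! ### Left Jost solutions -/

section LeftJost

variable {a b : ℤ → ℝ} {α β x : ℝ} {z : ℂ} {ψ : ℤ → ℂ}

lemma exists_left_jost (ha : ∀ n, a n ≠ 0) (hα : α ≠ 0)
    (hsa : Summable fun n : ℕ => |a (-n - 1) - α|) (hsb : Summable fun n : ℕ => |b (-n) - β|)
    (hz0 : z ≠ 0) (hz : ‖z‖ ≤ 1) (hz2 : z ^ 2 ≠ 1) :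
    ∃ ψ, IsJacobiSolution a b (β + α * (z + z⁻¹)) ψ ∧
      Tendsto (fun n : ℤ => z ^ n * ψ n) atBot (𝓝 1) := by
  obtain ⟨ψ, hψ, hl⟩ := exists_jost (a := fun n => a (-n - 1)) (b := fun n => b (-n))
    (fun n => ha _) hα hsa hsb hz0 hz hz2
  refine ⟨fun n => ψ (-n), by simpa using hψ.reflect, ?_⟩
  simpa [Function.comp_def] using hl.comp tendsto_neg_atBot_atTop

lemma tendsto_jost_reflect (hl : Tendsto (fun n : ℤ => z ^ n * ψ n) atBot (𝓝 1)) :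
    Tendsto (fun n : ℤ => z ^ (-n) * ψ (-n)) atTop (𝓝 1) :=
  hl.comp tendsto_neg_atTop_atBot

lemma tendsto_reflect (ha : Tendsto a atBot (𝓝 α)) :
    Tendsto (fun k => a (-k - 1)) atTop (𝓝 α) :=
  ha.comp (tendsto_atBot_add_const_right _ _ tendsto_neg_atTop_atBot)

lemma left_wronskian_conj_of_norm_eq_one (ha : Tendsto a atBot (𝓝 α)) (hz : ‖z‖ = 1)
    (hψ : IsJacobiSolution a b x ψ) (hl : Tendsto (fun n : ℤ => z ^ n * ψ n) atBot (𝓝 1))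
    (n : ℤ) : wronskian a ψ (fun k => conj (ψ k)) n = -(α * (z⁻¹ - z)) := by
  rw [← wronskian_conj_of_norm_eq_one (tendsto_reflect ha) hz hψ.reflect
    (tendsto_jost_reflect hl) (1 - n), wronskian_reflect a ψ (fun k => conj (ψ k)),
    sub_sub_cancel, neg_neg]

lemma left_wronskian_conj_of_norm_lt_one (ha : Tendsto a atBot (𝓝 α)) (hz0 : z ≠ 0)
    (hz : ‖z‖ < 1) (hψ : IsJacobiSolution a b x ψ)
    (hl : Tendsto (fun n : ℤ => z ^ n * ψ n) atBot (𝓝 1)) (n : ℤ) :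
    wronskian a ψ (fun k => conj (ψ k)) n = 0 := by
  rw [← neg_eq_zero, ← wronskian_conj_of_norm_lt_one (tendsto_reflect ha) hz0 hz hψ.reflect
    (tendsto_jost_reflect hl) (1 - n), wronskian_reflect a ψ (fun k => conj (ψ k)),
    sub_sub_cancel]

lemma exists_ne_zero_of_tendsto_left_jost
    (hl : Tendsto (fun n : ℤ => z ^ n * ψ n) atBot (𝓝 1)) : ∃ n, ψ n ≠ 0 := by
  obtain ⟨n, hn⟩ := exists_ne_zero_of_tendsto_jost (tendsto_jost_reflect hl)
  exact ⟨-n, hn⟩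

end LeftJost

/-! ### The Wronskian of the Jost solutions on the two bands -/

/-- Jacobi coefficients that are summably close to the constant background `(d, -c)` at `-∞` and to
`(1/2, 0)` at `+∞`, where the two background spectra do not overlap. -/
structure IsSteplike (c d : ℝ) (a b : ℤ → ℝ) : Prop where
  d_pos : 0 < d
  separated : 2 * d < c - 1
  a_ne_zero : ∀ n, a n ≠ 0
  summable_left_a : Summable fun n : ℕ => |a (-n) - d|
  summable_left_b : Summable fun n : ℕ => |b (-n) + c|
  summable_right_a : Summable fun n : ℕ => |a n - 1 / 2|
  summable_right_b : Summable fun n : ℕ => |b n|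

lemma summable_of_summable_exp_mul_add {C : ℝ} (hC : 0 ≤ C) {u v : ℕ → ℝ} (hu : ∀ n, 0 ≤ u n)
    (hv : ∀ n, 0 ≤ v n) (h : Summable fun n : ℕ => Real.exp (C * n) * (u n + v n)) :
    Summable u ∧ Summable v := by
  have hle : ∀ n : ℕ, u n + v n ≤ Real.exp (C * n) * (u n + v n) := fun n =>
    le_mul_of_one_le_left (add_nonneg (hu n) (hv n)) (Real.one_le_exp (by positivity))
  exact ⟨h.of_nonneg_of_le hu fun n => (le_add_of_nonneg_right (hv n)).trans (hle n),
    h.of_nonneg_of_le hv fun n => (le_add_of_nonneg_left (hu n)).trans (hle n)⟩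

lemma IsShockData.isSteplike {c d : ℝ} {a b : ℤ → ℝ} (h : IsShockData c d a b) :
    IsSteplike c d a b := by
  obtain ⟨C, hC, hleft, hright⟩ := h.decay
  have hC0 : 0 ≤ C := by
    refine le_trans ?_ ((le_max_left _ _).trans hC)
    have := h.one_lt
    have := h.d_pos
    positivity
  obtain ⟨hla, hlb⟩ := summable_of_summable_exp_mul_add hC0 (fun _ => abs_nonneg _)
    (fun _ => abs_nonneg _) hleft
  obtain ⟨hra, hrb⟩ := summable_of_summable_exp_mul_add hC0 (fun _ => abs_nonneg _)
    (fun _ => abs_nonneg _) hright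
  exact ⟨h.d_pos, h.separated, fun n => (h.a_pos n).ne', hla, hlb, hra, hrb⟩

lemma tendsto_of_summable_abs_sub {u : ℕ → ℝ} {α : ℝ} (h : Summable fun n => |u n - α|) :
    Tendsto u atTop (𝓝 α) :=
  tendsto_iff_norm_sub_tendsto_zero.2 h.tendsto_atTop_zero

lemma tendsto_int_atTop {u : ℤ → ℝ} {α : ℝ} (h : Tendsto (fun n : ℕ => u n) atTop (𝓝 α)) :
    Tendsto u atTop (𝓝 α) := by
  rw [← Nat.map_cast_int_atTop]
  exact tendsto_map'_iff.2 h

lemma bandTwo_eq : bandTwo = Set.Icc ((0 : ℝ) - 2 * (1 / 2)) (0 + 2 * (1 / 2)) := by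
  norm_num [bandTwo]

lemma mem_Ioo_half {x : ℝ} (hx : x ∈ Set.Ioo (-1 : ℝ) 1) :
    x ∈ Set.Ioo ((0 : ℝ) - 2 * (1 / 2)) (0 + 2 * (1 / 2)) := by
  constructor <;> linarith [hx.1, hx.2]

lemma W_eq_wronskian (c d : ℝ) (a b : ℤ → ℝ) (x : ℝ) (σ : Side) :
    W c d a b x σ = wronskian a (ψ₁ c d a b x σ) (ψ₂ a b x σ) 1 := by
  simp [W, wronskian]

namespace IsSteplike

variable {c d : ℝ} {a b : ℤ → ℝ} {x : ℝ}

lemma tendsto_right (h : IsSteplike c d a b) : Tendsto a atTop (𝓝 (1 / 2)) :=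
  tendsto_int_atTop (tendsto_of_summable_abs_sub h.summable_right_a)

lemma tendsto_left (h : IsSteplike c d a b) : Tendsto a atBot (𝓝 d) := by
  have hneg : Tendsto (fun n : ℤ => a (-n)) atTop (𝓝 d) :=
    tendsto_int_atTop (tendsto_of_summable_abs_sub h.summable_left_a)
  simpa [Function.comp_def] using hneg.comp tendsto_neg_atBot_atTop

lemma disjoint_bands (h : IsSteplike c d a b) : Disjoint (bandOne c d) bandTwo :=
  Set.disjoint_left.2 fun x h₁ h₂ => by linarith [h.separated, h₁.2, h₂.1]

lemma notMem_edges_of_mem_Ioo_left (h : IsSteplike c d a b)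
    (hx : x ∈ Set.Ioo (-c - 2 * d) (-c + 2 * d)) : x ∉ edges c d := by
  rintro (rfl | rfl | rfl | rfl) <;> linarith [hx.1, hx.2, h.separated]

lemma notMem_edges_of_mem_Ioo_right (h : IsSteplike c d a b) (hx : x ∈ Set.Ioo (-1 : ℝ) 1) :
    x ∉ edges c d := by
  rintro (rfl | rfl | rfl | rfl) <;> linarith [hx.1, hx.2, h.separated, h.d_pos]

lemma isLeftJost_ψ₁ (h : IsSteplike c d a b) (hx : x ∉ edges c d) (σ : Side) :
    IsLeftJost c d a b x σ (ψ₁ c d a b x σ) := by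
  have h₁ : x ≠ -c - 2 * d := fun e => hx (Or.inl e)
  have h₂ : x ≠ -c + 2 * d := fun e => hx (Or.inr (Or.inl e))
  have hsa : Summable fun n : ℕ => |a (-n - 1) - d| :=
    ((summable_nat_add_iff 1).2 h.summable_left_a).congr fun n => by
      rw [Nat.cast_succ, neg_add']
  obtain ⟨ψ, hψ⟩ := exists_left_jost (β := -c) h.a_ne_zero h.d_pos.ne' hsa
    (by simpa only [sub_neg_eq_add] using h.summable_left_b) (zAt_ne_zero h.d_pos.ne' (-c) x σ)
    (norm_zAt_le_one h.d_pos h₁ h₂ σ) (zAt_sq_ne_one h.d_pos.ne' (rootAt_ne_zero h₁ h₂ σ))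
  rw [add_mul_zAt_add_inv h.d_pos.ne'] at hψ
  exact Classical.epsilon_spec (p := IsLeftJost c d a b x σ) ⟨ψ, hψ⟩

lemma isRightJost_ψ₂ (h : IsSteplike c d a b) (hx : x ∉ edges c d) (σ : Side) :
    IsRightJost a b x σ (ψ₂ a b x σ) := by
  have hhalf : (0 : ℝ) < 1 / 2 := one_half_pos
  have h₁ : x ≠ 0 - 2 * (1 / 2) := fun e => hx (by norm_num at e; simp [edges, e])
  have h₂ : x ≠ 0 + 2 * (1 / 2) := fun e => hx (by norm_num at e; simp [edges, e])
  obtain ⟨ψ, hψ⟩ := exists_jost (β := 0) h.a_ne_zero hhalf.ne' h.summable_right_a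
    (by simpa only [sub_zero] using h.summable_right_b) (zAt_ne_zero hhalf.ne' 0 x σ)
    (norm_zAt_le_one hhalf h₁ h₂ σ) (zAt_sq_ne_one hhalf.ne' (rootAt_ne_zero h₁ h₂ σ))
  rw [add_mul_zAt_add_inv hhalf.ne'] at hψ
  exact Classical.epsilon_spec (p := IsRightJost a b x σ) ⟨ψ, hψ⟩

lemma wronskian_ψ₁_conj_ne_zero (h : IsSteplike c d a b)
    (hx : x ∈ Set.Ioo (-c - 2 * d) (-c + 2 * d)) (σ : Side) :
    wronskian a (ψ₁ c d a b x σ) (fun k => conj (ψ₁ c d a b x σ k)) 1 ≠ 0 := by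
  obtain ⟨hψ, hl⟩ := h.isLeftJost_ψ₁ (h.notMem_edges_of_mem_Ioo_left hx) σ
  rw [left_wronskian_conj_of_norm_eq_one h.tendsto_left (norm_zAt_eq_one h.d_pos.ne' hx σ) hψ hl,
    mul_zAt_inv_sub h.d_pos.ne']
  exact neg_ne_zero.2 (rootAt_ne_zero hx.1.ne' hx.2.ne σ)

lemma wronskian_ψ₂_conj_eq_zero (h : IsSteplike c d a b)
    (hx : x ∈ Set.Ioo (-c - 2 * d) (-c + 2 * d)) (σ : Side) :
    wronskian a (ψ₂ a b x σ) (fun k => conj (ψ₂ a b x σ k)) 1 = 0 := by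
  obtain ⟨hφ, hl⟩ := h.isRightJost_ψ₂ (h.notMem_edges_of_mem_Ioo_left hx) σ
  have hoff := h.disjoint_bands.notMem_of_mem_left (Set.Ioo_subset_Icc_self hx)
  rw [bandTwo_eq] at hoff
  exact wronskian_conj_of_norm_lt_one h.tendsto_right (zAt_ne_zero one_half_pos.ne' 0 x σ)
    (norm_zAt_lt_one one_half_pos hoff σ) hφ hl 1

lemma W_ne_zero_of_mem_Ioo_left (h : IsSteplike c d a b)
    (hx : x ∈ Set.Ioo (-c - 2 * d) (-c + 2 * d)) (σ : Side) :
    W c d a b x σ ≠ 0 := by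
  have hedge := h.notMem_edges_of_mem_Ioo_left hx
  rw [W_eq_wronskian]
  exact wronskian_ne_zero_of_wronskian_conj_eq_zero (h.isLeftJost_ψ₁ hedge σ).1
    (h.isRightJost_ψ₂ hedge σ).1 (h.wronskian_ψ₁_conj_ne_zero hx σ)
    (h.wronskian_ψ₂_conj_eq_zero hx σ)
    (exists_ne_zero_of_tendsto_jost (h.isRightJost_ψ₂ hedge σ).2)

lemma wronskian_ψ₂_conj_ne_zero (h : IsSteplike c d a b) (hx : x ∈ Set.Ioo (-1 : ℝ) 1) (σ : Side) :
    wronskian a (ψ₂ a b x σ) (fun k => conj (ψ₂ a b x σ k)) 1 ≠ 0 := by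
  obtain ⟨hψ, hl⟩ := h.isRightJost_ψ₂ (h.notMem_edges_of_mem_Ioo_right hx) σ
  rw [wronskian_conj_of_norm_eq_one h.tendsto_right
    (norm_zAt_eq_one one_half_pos.ne' (mem_Ioo_half hx) σ) hψ hl,
    mul_zAt_inv_sub one_half_pos.ne']
  exact rootAt_ne_zero (mem_Ioo_half hx).1.ne' (mem_Ioo_half hx).2.ne σ

lemma wronskian_ψ₁_conj_eq_zero (h : IsSteplike c d a b) (hx : x ∈ Set.Ioo (-1 : ℝ) 1) (σ : Side) :
    wronskian a (ψ₁ c d a b x σ) (fun k => conj (ψ₁ c d a b x σ k)) 1 = 0 := by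
  obtain ⟨hφ, hl⟩ := h.isLeftJost_ψ₁ (h.notMem_edges_of_mem_Ioo_right hx) σ
  have hoff := h.disjoint_bands.notMem_of_mem_right (Set.Ioo_subset_Icc_self hx)
  exact left_wronskian_conj_of_norm_lt_one h.tendsto_left (zAt_ne_zero h.d_pos.ne' (-c) x σ)
    (norm_zAt_lt_one h.d_pos hoff σ) hφ hl 1

lemma W_ne_zero_of_mem_Ioo_right (h : IsSteplike c d a b) (hx : x ∈ Set.Ioo (-1 : ℝ) 1) (σ : Side) :
    W c d a b x σ ≠ 0 := by
  have hedge := h.notMem_edges_of_mem_Ioo_right hx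
  rw [W_eq_wronskian, wronskian_swap, neg_ne_zero]
  exact wronskian_ne_zero_of_wronskian_conj_eq_zero (h.isRightJost_ψ₂ hedge σ).1
    (h.isLeftJost_ψ₁ hedge σ).1 (h.wronskian_ψ₂_conj_ne_zero hx σ)
    (h.wronskian_ψ₁_conj_eq_zero hx σ)
    (exists_ne_zero_of_tendsto_left_jost (h.isLeftJost_ψ₁ hedge σ).2)

end IsSteplike

/-! ### The form of the jump matrices -/

lemma ownJump_eq (t : ℝ) (R : ℂ) {Φ : ℂ} (hΦ : Φ.re = 0) : ownJump t R Φ =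
    !![0, -conj (R * Complex.exp (2 * t * Φ)); R * Complex.exp (2 * t * Φ), 1] := by
  have hconj : conj Φ = -Φ := Complex.ext (by simp [hΦ]) (by simp)
  rw [ownJump, map_mul, ← Complex.exp_conj, map_mul, map_mul, hconj]
  simp [Complex.conj_ofNat]

lemma crossJump_eq {t : ℝ} {X Φ : ℂ} {k : ℤ} (hk : t * Φ.im = k * Real.pi) :
    crossJump t X (conj Φ) (-Φ) = !![X * Real.exp (2 * t * Φ.re), 1; 1, 0] := by
  have hdiff : (t : ℂ) * (conj Φ - -Φ) = (2 * t * Φ.re : ℝ) := by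
    rw [sub_neg_eq_add, add_comm, Complex.add_conj]
    push_cast
    ring
  have hsum : (t : ℂ) * (conj Φ + -Φ) = -(k * (2 * Real.pi * Complex.I)) := by
    rw [← sub_eq_add_neg, ← neg_sub, Complex.sub_conj]
    have hk' : (t : ℂ) * Φ.im = k * Real.pi := mod_cast hk
    push_cast
    linear_combination (-2 * Complex.I) * hk'
  rw [crossJump, hdiff, hsum, neg_neg, Complex.exp_neg, Complex.exp_int_mul_two_pi_mul_I, inv_one,
    Complex.ofReal_exp]

/-- The phase of either background as a function of its Joukovski variable: at `x - i0` it is `Φ₁`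
for `α = d`, `z = z₁`, and `-Φ₂` for `α = 1/2`, `z = z₂`. -/
def phase (α ξ : ℝ) (z : ℂ) : ℂ := α * (z⁻¹ - z) - ξ * Complex.log z

lemma phase_re_eq_zero (α ξ : ℝ) {z : ℂ} (hz : ‖z‖ = 1) : (phase α ξ z).re = 0 := by
  rw [phase, Complex.inv_eq_conj hz, Complex.sub_re, Complex.re_ofReal_mul, Complex.re_ofReal_mul,
    Complex.log_re, hz, Real.log_one]
  simp

lemma exists_log_ofReal_im (u : ℝ) : ∃ k : ℤ, (Complex.log u).im = k * Real.pi := by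
  rw [Complex.log_im]
  rcases le_or_gt 0 u with hu | hu
  · exact ⟨0, by rw [Complex.arg_ofReal_of_nonneg hu]; simp⟩
  · exact ⟨1, by rw [Complex.arg_ofReal_of_neg hu]; simp⟩

lemma exists_phase_ofReal_im (α : ℝ) (n : ℤ) {t : ℝ} (ht : t ≠ 0) (u : ℝ) :
    ∃ k : ℤ, t * (phase α (n / t) u).im = k * Real.pi := by
  obtain ⟨k, hk⟩ := exists_log_ofReal_im u
  refine ⟨-(n * k), ?_⟩
  rw [phase, Complex.sub_im, Complex.im_ofReal_mul, Complex.im_ofReal_mul, hk,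
    ← Complex.ofReal_inv, ← Complex.ofReal_sub, Complex.ofReal_im]
  push_cast
  field_simp
  ring

lemma Φ₁_down_eq_phase (c d ξ x : ℝ) : Φ₁ c d ξ x .down = phase d ξ (z₁ c d x .down) := rfl

lemma Φ₂_down_eq_neg_phase (ξ x : ℝ) : Φ₂ ξ x .down = -phase (1 / 2) ξ (z₂ x .down) := by
  rw [Φ₂, phase]
  push_cast
  ring

lemma Φ₁_up (c d ξ x : ℝ) : Φ₁ c d ξ x .up = conj (Φ₁ c d ξ x .down) := rfl

lemma Φ₂_up (ξ x : ℝ) : Φ₂ ξ x .up = conj (Φ₂ ξ x .down) := rfl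

lemma χ_eq (c d : ℝ) (a b : ℤ → ℝ) (x : ℝ) (σ : Side) : χ c d a b x σ =
    -(rootAt d (-c) x σ * conj (rootAt (1 / 2) 0 x σ)) / (‖W c d a b x σ‖ ^ 2 : ℝ) := by
  rw [χ, T₁, T₂, Complex.ofReal_pow, ← Complex.mul_conj', map_div₀, map_neg, div_mul_div_comm]
  ring

lemma exists_v₁_eq_own {c d : ℝ} (hd : d ≠ 0) (a b : ℤ → ℝ) (n : ℤ) (t : ℝ) {x : ℝ}
    (hx : x ∈ Set.Ioo (-c - 2 * d) (-c + 2 * d)) :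
    ∃ ρ : ℂ, v₁ c d a b n t x .up = !![0, -conj ρ; ρ, 1] := by
  rw [v₁, if_pos (show x ∈ bandOne c d from Set.Ioo_subset_Icc_self hx)]
  refine ⟨_, ownJump_eq t _ ?_⟩
  rw [Φ₁_up, Complex.conj_re, Φ₁_down_eq_phase]
  exact phase_re_eq_zero _ _ (norm_zAt_eq_one hd hx .down)

lemma exists_v₂_eq_own (c d : ℝ) (a b : ℤ → ℝ) (n : ℤ) (t : ℝ) {x : ℝ}
    (hx : x ∈ Set.Ioo (-1 : ℝ) 1) :
    ∃ ρ : ℂ, v₂ c d a b n t x .up = !![0, -conj ρ; ρ, 1] := by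
  rw [v₂, if_pos (show x ∈ bandTwo from Set.Ioo_subset_Icc_self hx)]
  refine ⟨_, ownJump_eq t _ ?_⟩
  rw [Φ₂_up, Complex.conj_re, Φ₂_down_eq_neg_phase, Complex.neg_re, neg_eq_zero]
  exact phase_re_eq_zero _ _ (norm_zAt_eq_one one_half_pos.ne' (mem_Ioo_half hx) .down)

namespace IsSteplike

variable {c d : ℝ} {a b : ℤ → ℝ} {x t : ℝ}

lemma exists_v₁_eq_cross (h : IsSteplike c d a b) (n : ℤ) (ht : t ≠ 0)
    (hx : x ∈ Set.Ioo (-1 : ℝ) 1) : ∃ κ : ℝ, 0 < κ ∧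
      v₁ c d a b n t x .up = !![-(Complex.I * κ * cutRoot d (-c) x), 1; 1, 0] := by
  have hoff := h.disjoint_bands.notMem_of_mem_right (Set.Ioo_subset_Icc_self hx)
  obtain ⟨u, hu⟩ := exists_zAt_eq_ofReal h.d_pos hoff .down
  obtain ⟨k, hk⟩ := exists_phase_ofReal_im d n ht u
  rw [← hu, ← z₁, ← Φ₁_down_eq_phase] at hk
  obtain ⟨s₁, -, hs₁⟩ := exists_cutRoot_eq_ofReal h.d_pos hoff
  obtain ⟨s₂, hs₂, hs₂_eq⟩ := exists_cutRoot_eq_I_mul (mem_Ioo_half hx)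
  have hW : 0 < ‖W c d a b x .up‖ := norm_pos_iff.2 (h.W_ne_zero_of_mem_Ioo_right hx .up)
  refine ⟨s₂ / ‖W c d a b x .up‖ ^ 2 * Real.exp (2 * t * (Φ₁ c d (n / t) x .down).re),
    by positivity, ?_⟩
  rw [v₁, if_neg hoff, Φ₁_up, Φ₁Minus, Side.flip, crossJump_eq hk, χ_eq]
  congr 3
  simp only [rootAt, hs₁, hs₂_eq, map_div₀, map_neg, map_mul, Complex.conj_conj,
    Complex.conj_ofReal, Complex.ofReal_mul, Complex.ofReal_div]
  ring

lemma exists_v₂_eq_cross (h : IsSteplike c d a b) (n : ℤ) (ht : t ≠ 0)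
    (hx : x ∈ Set.Ioo (-c - 2 * d) (-c + 2 * d)) : ∃ κ : ℝ, 0 < κ ∧
      v₂ c d a b n t x .up = !![-(Complex.I * κ * cutRoot (1 / 2 : ℝ) (0 : ℝ) x), 1; 1, 0] := by
  have hoff := h.disjoint_bands.notMem_of_mem_left (Set.Ioo_subset_Icc_self hx)
  have hoff' := hoff
  rw [bandTwo_eq] at hoff'
  obtain ⟨u, hu⟩ := exists_zAt_eq_ofReal one_half_pos hoff' .down
  obtain ⟨k, hk⟩ := exists_phase_ofReal_im (1 / 2) n ht u
  have hk' : t * (Φ₂ (n / t) x .down).im = (-k : ℤ) * Real.pi := by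
    rw [Φ₂_down_eq_neg_phase, z₂, hu, Complex.neg_im, mul_neg, hk]
    push_cast
    ring
  obtain ⟨s₁, hs₁, hs₁_eq⟩ := exists_cutRoot_eq_I_mul hx
  obtain ⟨s₂, -, hs₂⟩ := exists_cutRoot_eq_ofReal one_half_pos hoff'
  have hW : 0 < ‖W c d a b x .up‖ := norm_pos_iff.2 (h.W_ne_zero_of_mem_Ioo_left hx .up)
  refine ⟨s₁ / ‖W c d a b x .up‖ ^ 2 * Real.exp (2 * t * (Φ₂ (n / t) x .down).re),
    by positivity, ?_⟩
  rw [v₂, if_neg hoff, Φ₂_up, Φ₂Minus, Side.flip, crossJump_eq hk', χ_eq]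
  congr 3
  simp only [rootAt, hs₁_eq, hs₂, Complex.conj_ofReal, Complex.ofReal_mul, Complex.ofReal_div]
  ring

theorem hasJumpForm_v₁ (h : IsSteplike c d a b) (n : ℤ) (ht : t ≠ 0) :
    HasJumpForm c d d (-c) (-1) 1 (v₁ c d a b n t) where
  pos := h.d_pos
  lt := by norm_num
  disjoint := h.disjoint_bands.symm
  bands_eq := rfl
  own _ hx := exists_v₁_eq_own h.d_pos.ne' a b n t hx
  cross _ hx := h.exists_v₁_eq_cross n ht hx

theorem hasJumpForm_v₂ (h : IsSteplike c d a b) (n : ℤ) (ht : t ≠ 0) :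
    HasJumpForm c d (1 / 2) 0 (-c - 2 * d) (-c + 2 * d) (v₂ c d a b n t) where
  pos := one_half_pos
  lt := by linarith [h.d_pos]
  disjoint := bandTwo_eq ▸ h.disjoint_bands
  bands_eq := by rw [← bandTwo_eq, bandOne, Set.union_comm]
  own x hx := exists_v₂_eq_own c d a b n t (by norm_num at hx; exact hx)
  cross _ hx := h.exists_v₂_eq_cross n ht hx

end IsSteplike

end TodaShock

end

theorem mainTheorem6_general (c d : ℝ) (a b : ℤ → ℝ) (h : TodaShock.IsSteplike c d a b)
    (n : ℤ) (t : ℝ) (ht : t ≠ 0) :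
    ∀ v ∈ ({TodaShock.v₁ c d a b n t, TodaShock.v₂ c d a b n t} :
        Set (ℝ → TodaShock.Side → Matrix (Fin 2) (Fin 2) ℂ)),
      (∀ m m' : TodaShock.SurfPt → Fin 2 → ℂ,
        TodaShock.IsSolution c d v m → TodaShock.IsSolution c d v m' →
          Set.EqOn m m' (TodaShock.offContour c d)) ∧
      (∀ m : TodaShock.SurfPt → Fin 2 → ℂ,
        TodaShock.IsVanishingSolution c d v m → ∀ p ∈ TodaShock.offContour c d, m p = 0) := by
  rintro v (rfl | rfl)
  · exact ⟨fun _ _ => (h.hasJumpForm_v₁ n ht).eqOn_of_isSolution,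
      fun _ => (h.hasJumpForm_v₁ n ht).eqOn_zero_of_vanishing⟩
  · exact ⟨fun _ _ => (h.hasJumpForm_v₂ n ht).eqOn_of_isSolution,
      fun _ => (h.hasJumpForm_v₂ n ht).eqOn_zero_of_vanishing⟩

theorem mainTheorem6 (c d : ℝ) (a b : ℤ → ℝ) (h : TodaShock.IsShockData c d a b)
    (n : ℤ) (t : ℝ) (ht : 0 < t) :
    ∀ v ∈ ({TodaShock.v₁ c d a b n t, TodaShock.v₂ c d a b n t} :
        Set (ℝ → TodaShock.Side → Matrix (Fin 2) (Fin 2) ℂ)),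
      (∀ m m' : TodaShock.SurfPt → Fin 2 → ℂ,
        TodaShock.IsSolution c d v m → TodaShock.IsSolution c d v m' →
          Set.EqOn m m' (TodaShock.offContour c d)) ∧
      (∀ m : TodaShock.SurfPt → Fin 2 → ℂ,
        TodaShock.IsVanishingSolution c d v m → ∀ p ∈ TodaShock.offContour c d, m p = 0) :=
  mainTheorem6_general c d a b h.isSteplike n t ht.ne'
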